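/- **Conventions.** Everything is over $\mathbb C$ and $\mathbb Z$-graded; "finite-dimensional" means of finite total dimension; $A_\infty$-categories and right $A_\infty$-modules are strictly unital. An $A_\infty$-category $\mathcal A$ has operations $\mu_{\mathcal A}^d$ ($d\ge 1$) of degree $2-d$, taking $(a_d,\dots,a_1)$, $a_k\in\hom_{\mathcal A}(X_{k-1},X_k)$, to $\hom_{\mathcal A}(X_0,X_d)$, with $$\sum_{i,j}(-1)^{|a_1|+\cdots+|a_i|-i}\mu_{\mathcal A}^{d-j+1}(a_d,\dots,\mu_{\mathcal A}^j(a_{i+j},\dots,a_{i+1}),a_i,\dots,a_1)=0,$$ and strict units $e_X\in\hom^0_{\mathcal A}(X,X)$: $\mu^1(e_X)=0$, $\mu^2(a,e_{X_0})=a$ and $\mu^2(e_{X_1},a)=(-1)^{|a|}a$ for $a\in\hom_{\mathcal A}(X_0,X_1)$, and $\mu^d(\dots,e_X,\dots)=0$ for $d\ge 3$. A right $A_\infty$-module $\mathcal M$ assigns to each object $X$ a graded vector space $\mathcal M(X)$, together with operations $\mu_{\mathcal M}^{d+1}:\mathcal M(X_d)\otimes\hom_{\mathcal A}(X_{d-1},X_d)\otimes\cdots\otimes\hom_{\mathcal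 A}(X_0,X_1)\to\mathcal M(X_0)$ ($d\ge 0$) of degree $1-d$, such that (with the signs $(-1)^{|a_1|+\cdots+|a_i|-i}$) the sum of all $\mu_{\mathcal M}(\mu_{\mathcal M}(m,a_d,\dots,a_{i+1}),a_i,\dots,a_1)$ and all $\mu_{\mathcal M}(m,a_d,\dots,\mu_{\mathcal A}(a_{i+j},\dots,a_{i+1}),a_i,\dots,a_1)$ vanishes, $\mu^2_{\mathcal M}(m,e_X)=m$, and $\mu^{d+1}_{\mathcal M}(m,\dots,e_X,\dots)=0$ for $d\ge 2$. $H^*(\mathcal M(X))$ is the cohomology of $\mu^1_{\mathcal M}$. A module homomorphism $t:\mathcal M\to\mathcal N$ consists of multilinear maps $t^{d+1}:\mathcal M(X_d)\otimes\hom_{\mathcal A}(X_{d-1},X_d)\otimes\cdots\otimes\hom_{\mathcal A}(X_0,X_1)\to\mathcal N(X_0)$ ($d\ge 0$) of degree $-d$ such that (with the same signs) the sum of all $\mu_{\mathcal N}(t(m,a_d,\dots,a_{i+1}),a_i,\dots,a_1)$, all $t(\mu_{\mathcal M}(m,a_d,\dots,a_{i+1}),a_i,\dots,a_1)$ and all $t(m,a_d,\dots,\mu_{\mathcal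 A}(a_{i+j},\dots,a_{i+1}),a_i,\dots,a_1)$ vanishes; it is a quasi-isomorphism if $t^1$ induces an isomorphism $H^*(\mathcal M(X))\to H^*(\mathcal N(X))$ for every object $X$. $\mathcal A$ is *directed* if it has finitely many ordered objects $X^1,\dots,X^m$, and $\hom_{\mathcal A}(X^i,X^j)$ is finite-dimensional for $i<j$, is one-dimensional and spanned by $e_{X^i}$ for $i=j$, and is zero for $i>j$. A *twisted complex* is a pair $(C,\delta)$, where $C=\bigoplus_{f\in F}W_f\otimes X_f$ is a formal sum with $F$ a finite set, $W_f$ finite-dimensional graded vector spaces and $X_f$ objects of $\mathcal A$; and $\delta\in\bigoplus_{f,g}\mathrm{Hom}(W_f,W_g)\otimes\hom_{\mathcal A}(X_f,X_g)$ has degree $1$, is strictly decreasing with respect to some filtration of $F$, and satisfies $\sum_{k\ge 1}\mu^k(\delta,\dots,\delta)=0$. Here $\mu^d(\phi_d\otimes x_d,\dots,\phi_1\otimes x_1)=(-1)^{\sum_{p<q}|\phi_p|(|x_q|-1)}\,\phi_d\cdots\phi_1\otimes\mu^d_{\mathcal A}(x_d,\dots,x_1)$. Its image under the Yoneda embedding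 is the $A_\infty$-module $\mathcal C$ with $\mathcal C(X)=\bigoplus_f W_f\otimes\hom_{\mathcal A}(X,X_f)$ and $$\mu_{\mathcal C}^{d+1}(c,a_d,\dots,a_1)=\sum_{k\ge 0}\mu^{k+1+d}(\underbrace{\delta,\dots,\delta}_{k},c,a_d,\dots,a_1).$$ **Proposition.** Let $\mathcal A$ be a directed $A_\infty$-category, and $\mathcal M$ an $A_\infty$-module over it such that $H^*(\mathcal M(X^k))$ is finite-dimensional for all $k$. Then there is a twisted complex over $\mathcal A$ whose image $\mathcal C$ under the Yoneda embedding is quasi-isomorphic to $\mathcal M$: there is a quasi-isomorphism of $A_\infty$-modules $\mathcal C\to\mathcal M$. -/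

import Mathlib

universe u v w w'

noncomputable section

/-- A `ℤ`-graded complex vector space: a vector space which is the internal direct sum of the
subspaces `gr n`, the elements of degree `n`. -/
structure GrVect : Type (v + 1) where
  carrier : Type v
  [acg : AddCommGroup carrier]
  [mod : Module ℂ carrier]
  gr : ℤ → Submodule ℂ carrier
  isInternal : DirectSum.IsInternal gr

namespace GrVect

instance : CoeSort GrVect.{v} (Type v) := ⟨GrVect.carrier⟩

attribute [instance] GrVect.acg GrVect.mod

/-- The linear map which multiplies an element `a` of degree `n` by `(-1) ^ (m * (n - 1))`. -/
def koszul (V : GrVect.{v}) (m : ℤ) : V →ₗ[ℂ] V :=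
  (DirectSum.toModule ℂ ℤ V
      (fun n => ((-1 : ℂ) ^ (m * (n - 1))) • (V.gr n).subtype)) ∘ₗ
    (LinearEquiv.ofBijective (DirectSum.coeLinearMap V.gr) V.isInternal).symm.toLinearMap

theorem koszul_apply (V : GrVect.{v}) (m n : ℤ) (a : V) (ha : a ∈ V.gr n) :
    V.koszul m a = ((-1 : ℂ) ^ (m * (n - 1))) • a := by
  have h : (LinearEquiv.ofBijective (DirectSum.coeLinearMap V.gr) V.isInternal).symm a
      = DirectSum.lof ℂ ℤ (fun n => V.gr n) n ⟨a, ha⟩ := by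
    rw [LinearEquiv.symm_apply_eq]
    rw [DirectSum.lof_eq_of]
    exact (DirectSum.coeLinearMap_of V.gr n ⟨a, ha⟩).symm
  simp [koszul, h]

theorem koszul_zero (V : GrVect.{v}) (a : V) : V.koszul 0 a = a := by
  have h : V.koszul 0 =
      (DirectSum.coeLinearMap V.gr) ∘ₗ
    (LinearEquiv.ofBijective (DirectSum.coeLinearMap V.gr) V.isInternal).symm.toLinearMap := by
    unfold koszul
    congr 1
    ext n x
    simp only [LinearMap.comp_apply, DirectSum.toModule_lof]
    rw [zero_mul, zpow_zero, one_smul, DirectSum.lof_eq_of, DirectSum.coeLinearMap_of]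
    rfl
  rw [h]
  exact (LinearEquiv.ofBijective (DirectSum.coeLinearMap V.gr) V.isInternal).apply_symm_apply a

/-- The finite direct sum of graded vector spaces `V i`, where the grading of `V i` is shifted up
by `r i`. -/
def shiftedSum {ι : Type} [Fintype ι] (V : ι → GrVect.{v}) (r : ι → ℤ) : GrVect.{v} where
  carrier := (i : ι) → V i
  gr n := Submodule.pi Set.univ (fun i => (V i).gr (n - r i))
  isInternal := by
    classical
    set G : ℤ → Submodule ℂ ((i : ι) → V i) :=
      fun n => Submodule.pi Set.univ (fun i => (V i).gr (n - r i)) with hG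
    constructor
    · rw [injective_iff_map_eq_zero]
      intro x hx
      have key : ∀ (i : ι) (n : ℤ), ((x n : G n) : (i : ι) → V i) i = 0 := by
        intro i n
        let p : (DirectSum ℤ fun n => G n) →+ (DirectSum ℤ fun m => (V i).gr m) :=
          DirectSum.toAddMonoid (fun n =>
            { toFun := fun y => DirectSum.of (fun m => (V i).gr m) (n - r i)
                ⟨(y : (i : ι) → V i) i, (Submodule.mem_pi.1 y.2) i trivial⟩
              map_zero' := by
                exact (DirectSum.of (fun m => (V i).gr m) (n - r i)).map_zero
              map_add' := fun y z => by
                rw [← (DirectSum.of (fun m => (V i).gr m) (n - r i)).map_add]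
                rfl })
        have h1 : ∀ y, DirectSum.coeAddMonoidHom (V i).gr (p y)
            = (DirectSum.coeAddMonoidHom G y) i := by
          intro y
          induction y using DirectSum.induction_on with
          | zero => simp
          | of n y => simp [p]
          | add y z hy hz => simp [hy, hz]
        have h2 : ∀ y : DirectSum ℤ fun n => G n,
            ((p y (n - r i) : (V i).gr (n - r i)) : V i) = (y n : (i : ι) → V i) i := by
          intro y
          induction y using DirectSum.induction_on with
          | zero => simp
          | of m y =>
            by_cases hmn : m = n
            · subst hmn
              simp [p]
            · have : m - r i ≠ n - r i := fun h => hmn (by linarith)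
              simp [p, DirectSum.of_eq_of_ne _ _ _ (Ne.symm hmn),
                DirectSum.of_eq_of_ne _ _ _ (Ne.symm this)]
          | add y z hy hz => simp [hy, hz]
        have h3 : p x = 0 := by
          apply (V i).isInternal.injective
          rw [h1, hx]
          simp
        rw [← h2, h3]
        simp
      refine DFinsupp.ext fun n => Subtype.ext ?_
      exact funext fun i => key i n
    · have htop : ∀ z : (i : ι) → V i, z ∈ LinearMap.range (DirectSum.coeLinearMap G) := by
        intro z
        rw [DirectSum.range_coeLinearMap]
        rw [← Finset.univ_sum_single z]
        refine Submodule.sum_mem _ fun i _ => ?_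
        have hz : z i ∈ ⨆ n, (V i).gr n := by
          rw [(V i).isInternal.submodule_iSup_eq_top]; trivial
        have hle : (⨆ n, (V i).gr n) ≤ (⨆ n, G n).comap (LinearMap.single ℂ (fun i => V i) i) := by
          refine iSup_le fun n a ha => ?_
          refine Submodule.mem_iSup_of_mem (n + r i) ?_
          rw [hG]
          refine Submodule.mem_pi.2 fun j _ => ?_
          by_cases hji : j = i
          · subst hji
            simpa using ha
          · simp [hji]
        exact hle hz
      intro z
      exact htop z

end GrVect

/-- Composable sequences `(a_d, …, a_1)`, `d ≥ 0`, with `a_k ∈ hom X_{k-1} X_k`,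
`X = X_0` and `Y = X_d`. -/
inductive Chain {Ob : Type u} (hom : Ob → Ob → GrVect.{v}) (X : Ob) : Ob → Type (max u v)
  | nil : Chain hom X X
  | cons {Y Z : Ob} (a : hom Y Z) (p : Chain hom X Y) : Chain hom X Z

namespace Chain

variable {Ob : Type u} {hom : Ob → Ob → GrVect.{v}}

/-- The number of entries of a composable sequence. -/
def length {X : Ob} : {Y : Ob} → Chain hom X Y → ℕ
  | _, nil => 0
  | _, cons _ p => p.length + 1

/-- Concatenation: `(a_d, …, a_{i+1})` and `(a_i, …, a_1)` give `(a_d, …, a_1)`. -/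
def comp {X Y : Ob} : {Z : Ob} → Chain hom Y Z → Chain hom X Y → Chain hom X Z
  | _, nil, p => p
  | _, cons a q, p => cons a (q.comp p)

/-- Multiply every entry `a_k` by `(-1) ^ (|a_k| - 1)`. A multilinear expression in the entries of a
homogeneous sequence `(a_i, …, a_1)` is thereby multiplied by `(-1) ^ (|a_1| + ⋯ + |a_i| - i)`. -/
def sgn {X : Ob} : {Y : Ob} → Chain hom X Y → Chain hom X Y
  | _, nil => nil
  | _, cons (Y := Y) (Z := Z) a p => cons ((hom Y Z).koszul 1 a) p.sgn

/-- All entries of the sequence are homogeneous, and `n = |a_1| + ⋯ + |a_d| - d`. -/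
def HasRedDeg {X : Ob} : {Y : Ob} → Chain hom X Y → ℤ → Prop
  | _, nil, n => n = 0
  | _, cons (Y := Y) (Z := Z) a p, n => ∃ k : ℤ, a ∈ (hom Y Z).gr k ∧ p.HasRedDeg (n - (k - 1))

theorem HasRedDeg.cons {X Y Z : Ob} {a : hom Y Z} {p : Chain hom X Y} {k n : ℤ}
    (ha : a ∈ (hom Y Z).gr k) (hp : p.HasRedDeg n) : (Chain.cons a p).HasRedDeg (k - 1 + n) :=
  ⟨k, ha, by rwa [add_sub_cancel_left]⟩

/-- A way of cutting a sequence into a left part and a right part. -/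
structure Split (hom : Ob → Ob → GrVect.{v}) (X Z : Ob) where
  mid : Ob
  left : Chain hom mid Z
  right : Chain hom X mid

/-- The list of the `d + 1` ways of cutting `(a_d, …, a_1)` into `(a_d, …, a_{i+1})` and
`(a_i, …, a_1)`; either part may be empty. -/
def splits {X : Ob} : {Z : Ob} → Chain hom X Z → List (Split hom X Z)
  | _, nil => [⟨X, nil, nil⟩]
  | Z, cons a p =>
      ⟨Z, nil, cons a p⟩ :: p.splits.map (fun s => ⟨s.mid, cons a s.left, s.right⟩)

/-- Linearity in each entry of the sequence. -/
structure IsMultilinear {X Z : Ob} {V : Type*} [AddCommGroup V] [Module ℂ V]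
    (Φ : Chain hom X Z → V) : Prop where
  map_add : ∀ {U W : Ob} (q : Chain hom W Z) (a b : hom U W) (p : Chain hom X U),
    Φ (q.comp (cons (a + b) p)) = Φ (q.comp (cons a p)) + Φ (q.comp (cons b p))
  map_smul : ∀ {U W : Ob} (q : Chain hom W Z) (t : ℂ) (a : hom U W) (p : Chain hom X U),
    Φ (q.comp (cons (t • a) p)) = t • Φ (q.comp (cons a p))

end Chain

/-- A strictly unital `A_∞`-category over `ℂ` with set of objects `Ob`.
For a sequence `c = (a_d, …, a_1)`, `mu c` is `μ^d(a_d, …, a_1)`. -/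
structure AInfCategory (Ob : Type u) where
  hom : Ob → Ob → GrVect.{v}
  mu : {X Y : Ob} → Chain hom X Y → hom X Y
  /-- The strict identity endomorphisms. -/
  one : (X : Ob) → hom X X
  /-- There is no operation `μ^0`. -/
  mu_nil : ∀ X : Ob, mu (Chain.nil : Chain hom X X) = 0
  mu_multilinear : ∀ X Y : Ob, Chain.IsMultilinear (mu : Chain hom X Y → hom X Y)
  /-- `μ^d` has degree `2 - d`. -/
  mu_mem : ∀ {X Y : Ob} (c : Chain hom X Y) (n : ℤ), c.HasRedDeg n → mu c ∈ (hom X Y).gr (n + 2)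
  /-- The `A_∞`-associativity equations: the sum of all
  `(-1) ^ (|a_1| + ⋯ + |a_i| - i) μ(a_d, …, μ(a_{i+j}, …, a_{i+1}), a_i, …, a_1)` vanishes. -/
  assoc : ∀ {X Y : Ob} (c : Chain hom X Y),
    (c.splits.map fun s =>
      (s.right.splits.map fun t =>
        mu (s.left.comp (Chain.cons (mu t.left) t.right.sgn))).sum).sum = 0
  one_mem : ∀ X : Ob, one X ∈ (hom X X).gr 0
  mu_one : ∀ X : Ob, mu (Chain.cons (one X) Chain.nil) = 0
  mu_right_one : ∀ {X Y : Ob} (a : hom X Y),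
    mu (Chain.cons a (Chain.cons (one X) Chain.nil)) = a
  mu_left_one : ∀ {X Y : Ob} (n : ℤ) (a : hom X Y), a ∈ (hom X Y).gr n →
    mu (Chain.cons (one Y) (Chain.cons a Chain.nil)) = ((-1 : ℂ) ^ n) • a
  /-- `μ^d` with `d ≥ 3` vanishes as soon as one entry is a strict identity. -/
  mu_insert_one : ∀ {X Y Z : Ob} (q : Chain hom Y Z) (p : Chain hom X Y),
    2 ≤ q.length + p.length → mu (q.comp (Chain.cons (one Y) p)) = 0

/-- An `A_∞`-category with objects `X^1, …, X^m` is directed if `hom(X^i, X^j)` is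
finite-dimensional for `i < j`, is `ℂ e` for `i = j`, and is zero for `i > j`. -/
structure AInfCategory.IsDirected {m : ℕ} (A : AInfCategory.{0, v} (Fin m)) : Prop where
  finiteDimensional : ∀ i j : Fin m, i < j → FiniteDimensional ℂ (A.hom i j)
  one_ne_zero : ∀ i : Fin m, A.one i ≠ 0
  span_one : ∀ i : Fin m, Submodule.span ℂ {A.one i} = ⊤
  eq_zero : ∀ i j : Fin m, j < i → ∀ a : A.hom i j, a = 0

/-- A strictly unital right `A_∞`-module. For a sequence `c = (a_d, …, a_1)` from `X_0` to `X_d` and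
`m ∈ M(X_d)`, `mu c m` is `μ^{d+1}(m, a_d, …, a_1) ∈ M(X_0)`. -/
structure AInfModule {Ob : Type u} (A : AInfCategory.{u, v} Ob) where
  obj : Ob → GrVect.{w}
  mu : {X Y : Ob} → Chain A.hom X Y → (obj Y →ₗ[ℂ] obj X)
  mu_multilinear : ∀ X Y : Ob,
    Chain.IsMultilinear (mu : Chain A.hom X Y → (obj Y →ₗ[ℂ] obj X))
  /-- `μ^{d+1}` has degree `1 - d`. -/
  mu_mem : ∀ {X Y : Ob} (c : Chain A.hom X Y) (n k : ℤ) (m : obj Y),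
    c.HasRedDeg n → m ∈ (obj Y).gr k → mu c m ∈ (obj X).gr (k + n + 1)
  /-- The sum of all `(-1) ^ (|a_1| + ⋯ + |a_i| - i) μ(μ(m, a_d, …, a_{i+1}), a_i, …, a_1)` and all
  `(-1) ^ (|a_1| + ⋯ + |a_i| - i) μ(m, a_d, …, μ_A(a_{i+j}, …, a_{i+1}), a_i, …, a_1)` vanishes. -/
  assoc : ∀ {X Y : Ob} (c : Chain A.hom X Y) (m : obj Y),
    (c.splits.map fun s => mu s.right.sgn (mu s.left m)).sum +
    (c.splits.map fun s =>
      (s.right.splits.map fun t =>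
        mu (s.left.comp (Chain.cons (A.mu t.left) t.right.sgn)) m).sum).sum = 0
  mu_one : ∀ {X : Ob} (m : obj X), mu (Chain.cons (A.one X) Chain.nil) m = m
  /-- `μ^{d+1}` with `d ≥ 2` vanishes as soon as one of the `a_k` is a strict identity. -/
  mu_insert_one : ∀ {X Y Z : Ob} (q : Chain A.hom Y Z) (p : Chain A.hom X Y) (m : obj Z),
    1 ≤ q.length + p.length → mu (q.comp (Chain.cons (A.one Y) p)) m = 0

namespace AInfModule

variable {Ob : Type u} {A : AInfCategory.{u, v} Ob}

/-- The differential `μ^1` on `M(X)`. -/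
def d (M : AInfModule.{u, v, w} A) (X : Ob) : M.obj X →ₗ[ℂ] M.obj X := M.mu (Chain.nil : Chain A.hom X X)

/-- The cohomology `H^*(M(X))`, as the total space `ker μ^1 / im μ^1`. -/
abbrev Cohomology (M : AInfModule.{u, v, w} A) (X : Ob) : Type w :=
  LinearMap.ker (M.d X) ⧸ (LinearMap.range (M.d X)).submoduleOf (LinearMap.ker (M.d X))

/-- A homomorphism of `A_∞`-modules, that is, a closed morphism of degree `0` in the
`A_∞`-category of modules: maps `t^{d+1}(m, a_d, …, a_1)` of degree `-d` with `μ^1(t) = 0`. -/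
structure Hom (M : AInfModule.{u, v, w} A) (N : AInfModule.{u, v, w'} A) where
  map : {X Y : Ob} → Chain A.hom X Y → (M.obj Y →ₗ[ℂ] N.obj X)
  map_multilinear : ∀ X Y : Ob,
    Chain.IsMultilinear (map : Chain A.hom X Y → (M.obj Y →ₗ[ℂ] N.obj X))
  map_mem : ∀ {X Y : Ob} (c : Chain A.hom X Y) (n k : ℤ) (m : M.obj Y),
    c.HasRedDeg n → m ∈ (M.obj Y).gr k → map c m ∈ (N.obj X).gr (k + n)
  /-- The three sums are those of all
  `(-1) ^ (|a_1| + ⋯ + |a_i| - i) μ_N(t(m, a_d, …, a_{i+1}), a_i, …, a_1)`, all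
  `(-1) ^ (|a_1| + ⋯ + |a_i| - i) t(μ_M(m, a_d, …, a_{i+1}), a_i, …, a_1)`, and all
  `(-1) ^ (|a_1| + ⋯ + |a_i| - i) t(m, a_d, …, μ_A(a_{i+j}, …, a_{i+1}), a_i, …, a_1)`. -/
  closed : ∀ {X Y : Ob} (c : Chain A.hom X Y) (m : M.obj Y),
    (c.splits.map fun s => N.mu s.right.sgn (map s.left m)).sum +
    (c.splits.map fun s => map s.right.sgn (M.mu s.left m)).sum +
    (c.splits.map fun s =>
      (s.right.splits.map fun r =>
        map (s.left.comp (Chain.cons (A.mu r.left) r.right.sgn)) m).sum).sum = 0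

namespace Hom

variable {M : AInfModule.{u, v, w} A} {N : AInfModule.{u, v, w'} A}

theorem d_map (t : Hom M N) (X : Ob) (m : M.obj X) :
    N.d X (t.map Chain.nil m) = - t.map Chain.nil (M.d X m) := by
  have h := t.closed Chain.nil m
  have h0 : t.map (Chain.cons (0 : A.hom X X) Chain.nil) m = 0 := by
    have := (t.map_multilinear X X).map_smul Chain.nil 0 (0 : A.hom X X) Chain.nil
    simp only [zero_smul, Chain.comp] at this
    rw [this]; rfl
  simp only [Chain.splits, Chain.sgn, Chain.comp, List.map_cons, List.map_nil, List.sum_cons,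
    List.sum_nil, add_zero, A.mu_nil, h0] at h
  exact eq_neg_of_add_eq_zero_left h

/-- The restriction of `t^1` to cocycles. -/
def cocycleMap (t : Hom M N) (X : Ob) : LinearMap.ker (M.d X) →ₗ[ℂ] LinearMap.ker (N.d X) :=
  (t.map Chain.nil).restrict (fun m hm => by
    rw [LinearMap.mem_ker] at hm ⊢
    rw [d_map, hm, map_zero, neg_zero])

/-- The map `H^*(M(X)) → H^*(N(X))` induced by `t^1`. (Since `t^1` anticommutes with the
differentials, one also finds the convention `[m] ↦ [(-1) ^ |m| t^1(m)]`; this sign does not affect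
bijectivity.) -/
def cohomologyMap (t : Hom M N) (X : Ob) : M.Cohomology X →ₗ[ℂ] N.Cohomology X :=
  Submodule.mapQ _ _ (t.cocycleMap X) (by
    rintro ⟨m, hm⟩ ⟨b, hb⟩
    refine ⟨- t.map Chain.nil b, ?_⟩
    have hb' : M.d X b = m := hb
    rw [map_neg, d_map, neg_neg, hb']
    rfl)

/-- A module homomorphism is a quasi-isomorphism if it induces isomorphisms on cohomology. -/
def IsQuasiIso (t : Hom M N) : Prop := ∀ X : Ob, Function.Bijective (t.cohomologyMap X)

end Hom

/-- There is a quasi-isomorphism of `A_∞`-modules from `M` to `N`. -/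
def QuasiIsomorphic (M : AInfModule.{u, v, w} A) (N : AInfModule.{u, v, w'} A) : Prop :=
  ∃ t : Hom M N, t.IsQuasiIso

end AInfModule

/-- A formal direct sum `⨁_f W_f ⊗ X_f`, where `f` runs over a finite set and the `W_f` are
finite-dimensional graded vector spaces. Each `W_f` is given by a homogeneous basis `K f`, whose
elements have degrees `deg`. -/
structure FormalSum (Ob : Type u) where
  F : Type
  [fintypeF : Fintype F]
  K : F → Type
  [fintypeK : ∀ f, Fintype (K f)]
  deg : (f : F) → K f → ℤ
  X : F → Ob

namespace FormalSum

attribute [instance] FormalSum.fintypeF FormalSum.fintypeK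

/-- The set of all basis elements of all `W_f`. -/
abbrev Idx {Ob : Type u} (C : FormalSum Ob) : Type := Σ f : C.F, C.K f

/-- The object of the summand to which a basis element belongs. -/
abbrev objAt {Ob : Type u} (C : FormalSum Ob) (i : C.Idx) : Ob := C.X i.1

/-- The degree of a basis element. -/
abbrev wt {Ob : Type u} (C : FormalSum Ob) (i : C.Idx) : ℤ := C.deg i.1 i.2

variable {Ob : Type u} (A : AInfCategory.{u, v} Ob) (C : FormalSum Ob)

/-- Elements of `⨁_{f,g} Hom(W_f, W_g) ⊗ hom(X_f, X_g)`, as matrices: `δ i j` is the coefficient of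
the elementary matrix which takes the basis element `i` to the basis element `j`. -/
abbrev End : Type v := (i j : C.Idx) → A.hom (C.objAt i) (C.objAt j)

open Classical in
/-- `insertWords A C δ s k i (a_d, …, a_1)` is the sum of `μ(δ, …, δ, a_d, …, a_1)` (with `k` entries
`δ`) in the additive enlargement, where `a_d` has target the summand `i`; it is a vector whose `j`-th
component belongs to the summand `j`. The operations in the additive enlargement are
`μ(φ_d ⊗ x_d, …, φ_1 ⊗ x_1) = (-1)^◁ φ_d ⋯ φ_1 ⊗ μ(x_d, …, x_1)`, with
`◁ = ∑_{p < q} |φ_p| (|x_q| - 1)`. Since `|φ|` is the difference of the degrees of the basis elements,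
an entry `x_q` of `δ` with source the summand `i` contributes `(-1) ^ ((wt i - s) (|x_q| - 1))`, where
`s` is the degree of the basis element at the source of the whole expression. -/
def insertWords (δ : C.End A) (s : ℤ) {Y : Ob} :
    ℕ → (i : C.Idx) → Chain A.hom Y (C.objAt i) → ((j : C.Idx) → A.hom Y (C.objAt j))
  | 0, i, p => Pi.single i (A.mu p)
  | k + 1, i, p => ∑ j : C.Idx,
      insertWords δ s k j
        (Chain.cons ((A.hom (C.objAt i) (C.objAt j)).koszul (C.wt i - s) (δ i j)) p)

/-- The sum of all `μ(δ, …, δ, a_d, …, a_1)`, with any number of entries `δ`. If `δ` is strictly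
decreasing with respect to a filtration of `F`, words with more than `card F` entries `δ` vanish. -/
def insertAll (δ : C.End A) (s : ℤ) {Y : Ob} (i : C.Idx) (p : Chain A.hom Y (C.objAt i)) :
    (j : C.Idx) → A.hom Y (C.objAt j) :=
  ∑ k ∈ Finset.range (Fintype.card C.F + 1), C.insertWords A δ s k i p

end FormalSum

/-- A twisted complex: a formal sum with a differential `δ` of degree `1`, strictly decreasing with
respect to a filtration of `F`, and satisfying the generalized Maurer-Cartan equation. -/
structure TwistedComplex {Ob : Type u} (A : AInfCategory.{u, v} Ob) extends FormalSum Ob where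
  δ : toFormalSum.End A
  δ_mem : ∀ i j, δ i j ∈ (A.hom (toFormalSum.objAt i) (toFormalSum.objAt j)).gr
    (1 + toFormalSum.wt i - toFormalSum.wt j)
  exists_filtration : ∃ lvl : F → ℕ, ∀ i j : toFormalSum.Idx, ¬ lvl j.1 < lvl i.1 → δ i j = 0
  maurerCartan : ∀ i, toFormalSum.insertAll A δ (toFormalSum.wt i) i
    Chain.nil = 0

namespace Chain

variable {Ob : Type u} {hom : Ob → Ob → GrVect.{v}}

theorem comp_nil_left {X Y : Ob} (p : Chain hom X Y) : (nil : Chain hom Y Y).comp p = p := rfl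

theorem comp_cons {W X Y Z : Ob} (a : hom Y Z) (q : Chain hom X Y) (p : Chain hom W X) :
    (cons a q).comp p = cons a (q.comp p) := rfl

theorem IsMultilinear.map_zero {X Z : Ob} {V : Type*} [AddCommGroup V] [Module ℂ V]
    {Φ : Chain hom X Z → V} (h : IsMultilinear Φ) {U W : Ob} (q : Chain hom W Z)
    (p : Chain hom X U) : Φ (q.comp (cons (0 : hom U W) p)) = 0 := by
  have := h.map_smul q 0 (0 : hom U W) p
  rwa [zero_smul, zero_smul] at this

/-- A multilinear expression, as a linear map of one of the entries. -/
def IsMultilinear.toLinear {X Z : Ob} {V : Type*} [AddCommGroup V] [Module ℂ V]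
    {Φ : Chain hom X Z → V} (h : IsMultilinear Φ) {U W : Ob} (q : Chain hom W Z)
    (p : Chain hom X U) : hom U W →ₗ[ℂ] V where
  toFun a := Φ (q.comp (cons a p))
  map_add' a b := h.map_add q a b p
  map_smul' t a := h.map_smul q t a p

end Chain

namespace TwistedComplex

variable {Ob : Type u} {A : AInfCategory.{u, v} Ob} (C : TwistedComplex A)

open FormalSum

theorem insertWords_multilinear (s : ℤ) {Y : Ob} (k : ℕ) (i : C.Idx) :
    Chain.IsMultilinear (C.insertWords A C.δ s k i : Chain A.hom Y (C.objAt i) → _) := by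
  induction k generalizing i with
  | zero =>
    refine ⟨fun q a b p => ?_, fun q t a p => ?_⟩
    · simp only [insertWords, (A.mu_multilinear _ _).map_add, Pi.single_add]
    · simp only [insertWords, (A.mu_multilinear _ _).map_smul, Pi.single_smul]
  | succ k ih =>
    refine ⟨fun q a b p => ?_, fun q t a p => ?_⟩
    · simp only [insertWords]
      rw [← Finset.sum_add_distrib]
      exact Finset.sum_congr rfl fun j _ => (ih j).map_add (Chain.cons ((A.hom (C.objAt i) (C.objAt j)).koszul (C.wt i - s) (C.δ i j)) q) a b p
    · simp only [insertWords]
      rw [Finset.smul_sum]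
      exact Finset.sum_congr rfl fun j _ => (ih j).map_smul (Chain.cons ((A.hom (C.objAt i) (C.objAt j)).koszul (C.wt i - s) (C.δ i j)) q) t a p

theorem insertAll_multilinear (s : ℤ) {Y : Ob} (i : C.Idx) :
    Chain.IsMultilinear (C.insertAll A C.δ s i : Chain A.hom Y (C.objAt i) → _) := by
  refine ⟨fun q a b p => ?_, fun q t a p => ?_⟩
  · simp only [insertAll]
    rw [← Finset.sum_add_distrib]
    exact Finset.sum_congr rfl fun k _ => (C.insertWords_multilinear s k i).map_add q a b p
  · simp only [insertAll]
    rw [Finset.smul_sum]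
    exact Finset.sum_congr rfl fun k _ => (C.insertWords_multilinear s k i).map_smul q t a p

theorem insertWords_eq_zero (s : ℤ) {Y : Ob} (lvl : C.F → ℕ)
    (h : ∀ i j : C.Idx, ¬ lvl j.1 < lvl i.1 → C.δ i j = 0) (k : ℕ) (i : C.Idx)
    (p : Chain A.hom Y (C.objAt i))
    (hk : (Finset.univ.filter fun f => lvl f < lvl i.1).card < k) :
    C.insertWords A C.δ s k i p = 0 := by
  induction k generalizing i with
  | zero => omega
  | succ k ih =>
    simp only [insertWords]
    refine Finset.sum_eq_zero fun j _ => ?_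
    by_cases hj : lvl j.1 < lvl i.1
    · refine ih j _ (lt_of_lt_of_le (Finset.card_lt_card ?_) (Nat.lt_succ_iff.1 hk))
      rw [Finset.ssubset_iff_of_subset]
      · exact ⟨j.1, by simp [hj], by simp⟩
      · intro f hf
        simp only [Finset.mem_filter, Finset.mem_univ, true_and] at hf ⊢
        omega
    · rw [h i j hj, map_zero]
      exact (C.insertWords_multilinear s k j).map_zero Chain.nil p

open Classical in
theorem insertAll_eq (s : ℤ) {Y : Ob} (i : C.Idx) (p : Chain A.hom Y (C.objAt i)) :
    C.insertAll A C.δ s i p = Pi.single i (A.mu p) +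
      ∑ j : C.Idx, C.insertAll A C.δ s j
        (Chain.cons ((A.hom (C.objAt i) (C.objAt j)).koszul (C.wt i - s) (C.δ i j)) p) := by
  obtain ⟨lvl, h⟩ := C.exists_filtration
  have h0 : C.insertWords A C.δ s (Fintype.card C.F + 1) i p = 0 := by
    refine C.insertWords_eq_zero s lvl h _ i p (Nat.lt_succ_iff.2 ?_)
    exact Finset.card_le_univ _
  have h1 : C.insertAll A C.δ s i p =
      ∑ k ∈ Finset.range (Fintype.card C.F + 1 + 1), C.insertWords A C.δ s k i p := by
    rw [Finset.sum_range_succ, h0, add_zero]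
    rfl
  rw [h1, Finset.sum_range_succ', add_comm]
  congr 1
  simp only [insertWords, insertAll]
  rw [Finset.sum_comm]

/-- The degree of the differential: the reduced degree of the entry `δ i j` is `wt i - wt j`. -/
theorem koszul_δ (s : ℤ) (i j : C.Idx) :
    (A.hom (C.objAt i) (C.objAt j)).koszul (C.wt i - s) (C.δ i j) =
      ((-1 : ℂ) ^ (s * C.wt i - s * C.wt j)) •
        (A.hom (C.objAt i) (C.objAt j)).koszul (C.wt i) (C.δ i j) := by
  rw [GrVect.koszul_apply _ _ _ _ (C.δ_mem i j), GrVect.koszul_apply _ _ _ _ (C.δ_mem i j),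
    smul_smul]
  congr 1
  rw [← zpow_add₀ (by norm_num : (-1 : ℂ) ≠ 0)]
  have e : (C.wt i - s) * (1 + C.wt i - C.wt j - 1) =
      (s * C.wt i - s * C.wt j + C.wt i * (1 + C.wt i - C.wt j - 1)) +
        2 * (-(s * (C.wt i - C.wt j))) := by ring
  rw [e, zpow_add₀ (by norm_num : (-1 : ℂ) ≠ 0), zpow_mul (-1 : ℂ) 2]
  norm_num

theorem insertWords_shift (s : ℤ) {Y : Ob} (k : ℕ) (i : C.Idx) (p : Chain A.hom Y (C.objAt i))
    (j : C.Idx) :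
    C.insertWords A C.δ s k i p j =
      ((-1 : ℂ) ^ (s * C.wt i - s * C.wt j)) • C.insertWords A C.δ 0 k i p j := by
  induction k generalizing i with
  | zero =>
    by_cases hij : j = i
    · subst hij
      simp [insertWords]
    · simp [insertWords, hij]
  | succ k ih =>
    simp only [insertWords, Finset.sum_apply]
    rw [Finset.smul_sum]
    refine Finset.sum_congr rfl fun l _ => ?_
    rw [ih, C.koszul_δ s, sub_zero]
    have := (C.insertWords_multilinear (Y := Y) 0 k l).map_smul Chain.nil
      ((-1 : ℂ) ^ (s * C.wt i - s * C.wt l))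
      ((A.hom (C.objAt i) (C.objAt l)).koszul (C.wt i) (C.δ i l)) p
    simp only [Chain.comp] at this
    rw [this, Pi.smul_apply, smul_smul, ← zpow_add₀ (by norm_num : (-1 : ℂ) ≠ 0)]
    congr 2
    ring

theorem insertAll_nil (i : C.Idx) :
    C.insertAll A C.δ 0 i Chain.nil = 0 := by
  funext j
  have h := congrFun (C.maurerCartan i) j
  have e : C.insertAll A C.δ (C.wt i) i Chain.nil j =
      ((-1 : ℂ) ^ (C.wt i * C.wt i - C.wt i * C.wt j)) •
        C.insertAll A C.δ 0 i Chain.nil j := by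
    simp only [insertAll, Finset.sum_apply]
    rw [Finset.smul_sum]
    exact Finset.sum_congr rfl fun k _ => C.insertWords_shift _ _ _ _ _
  rw [e] at h
  exact (smul_eq_zero.1 h).resolve_left (zpow_ne_zero _ (by norm_num))

theorem insertWords_mem {Y : Ob} (k : ℕ) (i : C.Idx) (p : Chain A.hom Y (C.objAt i)) (n : ℤ)
    (hp : p.HasRedDeg n) (j : C.Idx) :
    C.insertWords A C.δ 0 k i p j ∈ (A.hom Y (C.objAt j)).gr (n + 2 + C.wt i - C.wt j) := by
  induction k generalizing i n with
  | zero =>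
    by_cases hij : j = i
    · subst hij
      simpa [insertWords] using A.mu_mem p n hp
    · simp [insertWords, hij]
  | succ k ih =>
    simp only [insertWords, Finset.sum_apply]
    refine Submodule.sum_mem _ fun l _ => ?_
    have hd : (A.hom (C.objAt i) (C.objAt l)).koszul (C.wt i - 0) (C.δ i l) ∈
        (A.hom (C.objAt i) (C.objAt l)).gr (1 + C.wt i - C.wt l) := by
      rw [GrVect.koszul_apply _ _ _ _ (C.δ_mem i l)]
      exact Submodule.smul_mem _ _ (C.δ_mem i l)
    have := ih l _ _ (Chain.HasRedDeg.cons hd hp)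
    convert this using 2
    ring

theorem insertAll_mem {Y : Ob} (i : C.Idx) (p : Chain A.hom Y (C.objAt i)) (n : ℤ)
    (hp : p.HasRedDeg n) (j : C.Idx) :
    C.insertAll A C.δ 0 i p j ∈ (A.hom Y (C.objAt j)).gr (n + 2 + C.wt i - C.wt j) := by
  simp only [insertAll, Finset.sum_apply]
  exact Submodule.sum_mem _ fun k _ => C.insertWords_mem k i p n hp j

theorem insertAll_insert_one {X Y : Ob} (i : C.Idx) (q : Chain A.hom Y (C.objAt i))
    (p : Chain A.hom X Y) (h : 2 ≤ q.length + p.length) :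
    C.insertAll A C.δ 0 i (q.comp (Chain.cons (A.one Y) p)) = 0 := by
  simp only [insertAll]
  refine Finset.sum_eq_zero fun k hk => ?_
  clear hk
  induction k generalizing i with
  | zero => simp only [insertWords, A.mu_insert_one q p h, Pi.single_zero]
  | succ k ih =>
    simp only [insertWords]
    refine Finset.sum_eq_zero fun j _ => ?_
    exact ih j (Chain.cons ((A.hom (C.objAt i) (C.objAt j)).koszul (C.wt i - 0) (C.δ i j)) q) (by simp only [Chain.length]; omega)

theorem insertAll_right_one {X : Ob} (c : (i : C.Idx) → A.hom X (C.objAt i)) :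
    ∑ i : C.Idx, C.insertAll A C.δ 0 i (Chain.cons (c i) (Chain.cons (A.one X) Chain.nil)) =
      c := by
  classical
  rw [← Finset.univ_sum_single c]
  refine Finset.sum_congr rfl fun i _ => ?_
  rw [C.insertAll_eq, A.mu_right_one, Finset.univ_sum_single]
  rw [Finset.sum_eq_zero, add_zero]
  intro j _
  exact C.insertAll_insert_one j (Chain.cons
    ((A.hom (C.objAt i) (C.objAt j)).koszul (C.wt i - 0) (C.δ i j)) (Chain.cons (c i) Chain.nil))
    Chain.nil (by simp [Chain.length])

theorem insertAll_cons_zero {U Y : Ob} (j : C.Idx) (p : Chain A.hom Y U) :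
    C.insertAll A C.δ 0 j (Chain.cons (0 : A.hom U (C.objAt j)) p) = 0 :=
  (C.insertAll_multilinear 0 j).map_zero Chain.nil p

theorem insertAll_cons_sum {ι : Type*} (I : Finset ι) {U Y : Ob} (j : C.Idx)
    (f : ι → A.hom U (C.objAt j)) (p : Chain A.hom Y U) :
    C.insertAll A C.δ 0 j (Chain.cons (∑ i ∈ I, f i) p) =
      ∑ i ∈ I, C.insertAll A C.δ 0 j (Chain.cons (f i) p) :=
  map_sum ((C.insertAll_multilinear 0 j).toLinear Chain.nil p) f I

theorem insertAll_cons_add {U Y : Ob} (j : C.Idx)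
    (a b : A.hom U (C.objAt j)) (p : Chain A.hom Y U) :
    C.insertAll A C.δ 0 j (Chain.cons (a + b) p) =
      C.insertAll A C.δ 0 j (Chain.cons a p) + C.insertAll A C.δ 0 j (Chain.cons b p) :=
  (C.insertAll_multilinear 0 j).map_add Chain.nil a b p

/-- Operations applied after an operation involving the leftmost entries. -/
def outerSum {Y : Ob} (i : C.Idx) (p : Chain A.hom Y (C.objAt i)) :
    (j : C.Idx) → A.hom Y (C.objAt j) :=
  (p.splits.map fun t => ∑ k : C.Idx,
    C.insertAll A C.δ 0 k (Chain.cons (C.insertAll A C.δ 0 i t.left k) t.right.sgn)).sum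

/-- Operations applied after an operation in the given category. -/
def innerSum {Y : Ob} (i : C.Idx) (p : Chain A.hom Y (C.objAt i)) :
    (j : C.Idx) → A.hom Y (C.objAt j) :=
  (p.splits.map fun s => (s.right.splits.map fun t =>
    C.insertAll A C.δ 0 i (s.left.comp (Chain.cons (A.mu t.left) t.right.sgn))).sum).sum

/-- The part of the previous sum where the inner operation involves the leftmost entries. -/
def leftSum {Y : Ob} (i : C.Idx) (p : Chain A.hom Y (C.objAt i)) :
    (j : C.Idx) → A.hom Y (C.objAt j) :=
  (p.splits.map fun t =>
    C.insertAll A C.δ 0 i (Chain.cons (A.mu t.left) t.right.sgn)).sum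

theorem list_sum_comm {α M ι : Type*} [AddCommMonoid M] (I : Finset ι) (l : List α)
    (f : ι → α → M) :
    (l.map fun x => ∑ i ∈ I, f i x).sum = ∑ i ∈ I, (l.map (f i)).sum := by
  induction l with
  | nil => simp
  | cons a l ih => simp [ih, Finset.sum_add_distrib]

theorem list_sum_zero {α M : Type*} [AddCommMonoid M] (l : List α)
    (f : α → M) (h : ∀ x, f x = 0) : (l.map f).sum = 0 := by
  induction l with
  | nil => simp
  | cons a l ih => simp [ih, h]

theorem outerSum_cons {U Y : Ob} (j : C.Idx) (a : A.hom U (C.objAt j)) (p : Chain A.hom Y U) :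
    C.outerSum j (Chain.cons a p) = (p.splits.map fun t => ∑ k : C.Idx,
      C.insertAll A C.δ 0 k
        (Chain.cons (C.insertAll A C.δ 0 j (Chain.cons a t.left) k) t.right.sgn)).sum := by
  simp only [outerSum, Chain.splits, List.map_cons, List.sum_cons, List.map_map]
  rw [Finset.sum_eq_zero, zero_add]
  · rfl
  · intro k _
    rw [C.insertAll_nil j]
    exact C.insertAll_cons_zero k _

theorem innerSum_cons {U Y : Ob} (j : C.Idx) (a : A.hom U (C.objAt j)) (p : Chain A.hom Y U) :
    C.innerSum j (Chain.cons a p) = C.leftSum j (Chain.cons a p) +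
      (p.splits.map fun s => (s.right.splits.map fun t =>
        C.insertAll A C.δ 0 j
          (Chain.cons a (s.left.comp (Chain.cons (A.mu t.left) t.right.sgn)))).sum).sum := by
  simp only [innerSum]
  rw [Chain.splits]
  simp only [List.map_cons, List.sum_cons, List.map_map]
  rfl

theorem outer_add_inner {Y : Ob} (i : C.Idx) (p : Chain A.hom Y (C.objAt i)) :
    C.outerSum i p + C.innerSum i p = C.leftSum i p := by
  classical
  obtain ⟨lvl, h⟩ := C.exists_filtration
  induction hn : lvl i.1 using Nat.strong_induction_on generalizing i with
  | _ n ih =>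
  subst hn
  let δ' : (j : C.Idx) → A.hom (C.objAt i) (C.objAt j) :=
    fun j => (A.hom (C.objAt i) (C.objAt j)).koszul (C.wt i - 0) (C.δ i j)
  have hS : C.outerSum i p = C.leftSum i p + ∑ j, C.outerSum j (Chain.cons (δ' j) p) := by
    simp only [outerSum_cons]
    rw [← list_sum_comm]
    simp only [outerSum, leftSum]
    rw [← List.sum_map_add]
    congr 1
    refine List.map_congr_left fun t _ => ?_
    rw [Finset.sum_comm, ]
    simp only [← insertAll_cons_sum]
    have e : ∀ k : C.Idx, C.insertAll A C.δ 0 k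
          (Chain.cons (C.insertAll A C.δ 0 i t.left k) t.right.sgn) =
        C.insertAll A C.δ 0 k (Chain.cons
          ((Pi.single i (A.mu t.left) : (j : C.Idx) → A.hom t.mid (C.objAt j)) k) t.right.sgn) +
        C.insertAll A C.δ 0 k (Chain.cons
          (∑ j, C.insertAll A C.δ 0 j (Chain.cons (δ' j) t.left) k) t.right.sgn) := by
      intro k
      rw [← insertAll_cons_add]
      congr 2
      rw [C.insertAll_eq 0 i, Pi.add_apply, Finset.sum_apply]
    rw [Finset.sum_congr rfl fun k _ => e k, Finset.sum_add_distrib]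
    congr 1
    rw [Finset.sum_eq_single i]
    · rw [Pi.single_eq_same]
    · intro k _ hk
      rw [Pi.single_eq_of_ne hk]
      exact C.insertAll_cons_zero k _
    · simp
  have hB : C.innerSum i p = ∑ j, (C.innerSum j (Chain.cons (δ' j) p) -
      C.leftSum j (Chain.cons (δ' j) p)) := by
    simp only [innerSum_cons, add_sub_cancel_left]
    rw [← list_sum_comm]
    simp only [← list_sum_comm]
    have h0 : (p.splits.map fun s => (s.right.splits.map fun t =>
        (Pi.single i (A.mu (s.left.comp (Chain.cons (A.mu t.left) t.right.sgn))) :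
          (j : C.Idx) → A.hom Y (C.objAt j))).sum).sum = 0 := by
      have := congrArg (AddMonoidHom.single (fun j : C.Idx => A.hom Y (C.objAt j)) i) (A.assoc p)
      rw [map_zero, map_list_sum, List.map_map] at this
      rw [← this]
      congr 1
      refine List.map_congr_left fun s _ => ?_
      simp only [Function.comp]
      rw [map_list_sum, List.map_map]
      rfl
    rw [← zero_add (List.sum _), ← h0, ← List.sum_map_add]
    simp only [innerSum]
    congr 1
    refine List.map_congr_left fun s _ => ?_
    rw [← List.sum_map_add]
    congr 1
    refine List.map_congr_left fun t _ => ?_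
    exact C.insertAll_eq 0 i _
  rw [hS, hB, add_assoc, ← Finset.sum_add_distrib, Finset.sum_eq_zero, add_zero]
  intro j _
  by_cases hj : lvl j.1 < lvl i.1
  · rw [← add_sub_assoc, ih _ hj j _ rfl, sub_self]
  · have hz : δ' j = 0 := by
      simp only [δ', h i j hj, map_zero]
    rw [hz, innerSum_cons, add_sub_cancel_left, outerSum_cons]
    rw [list_sum_zero, list_sum_zero, add_zero]
    · intro s
      exact list_sum_zero _ _ fun t => C.insertAll_cons_zero j _
    · intro t
      refine Finset.sum_eq_zero fun k _ => ?_
      rw [C.insertAll_cons_zero j]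
      exact C.insertAll_cons_zero k _

/-- The linear map which takes `c` to the sum of all `μ(δ, …, δ, c, a_d, …, a_1)` with any number of
entries `δ`, for `c ∈ hom(Y, C) = ⨁_i W_i ⊗ hom(Y, X_i)`. -/
def yonedaMu {X Y : Ob} (p : Chain A.hom X Y) :
    ((i : C.Idx) → A.hom Y (C.objAt i)) →ₗ[ℂ] ((j : C.Idx) → A.hom X (C.objAt j)) where
  toFun c := ∑ i : C.Idx, C.insertAll A C.δ 0 i (Chain.cons (c i) p)
  map_add' c c' := by
    rw [← Finset.sum_add_distrib]
    exact Finset.sum_congr rfl fun i _ => C.insertAll_cons_add i (c i) (c' i) p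
  map_smul' t c := by
    rw [RingHom.id_apply, Finset.smul_sum]
    exact Finset.sum_congr rfl fun i _ =>
      (C.insertAll_multilinear 0 i).map_smul Chain.nil t (c i) p

theorem yonedaMu_apply {X Y : Ob} (p : Chain A.hom X Y) (c : (i : C.Idx) → A.hom Y (C.objAt i)) :
    C.yonedaMu p c = ∑ i : C.Idx, C.insertAll A C.δ 0 i (Chain.cons (c i) p) := rfl

theorem yonedaMu_multilinear (X Y : Ob) :
    Chain.IsMultilinear (C.yonedaMu : Chain A.hom X Y → _) := by
  refine ⟨fun q a b p => ?_, fun q t a p => ?_⟩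
  · refine LinearMap.ext fun c => ?_
    rw [LinearMap.add_apply, yonedaMu_apply, yonedaMu_apply, yonedaMu_apply,
      ← Finset.sum_add_distrib]
    exact Finset.sum_congr rfl fun i _ =>
      (C.insertAll_multilinear 0 i).map_add (Chain.cons (c i) q) a b p
  · refine LinearMap.ext fun c => ?_
    rw [LinearMap.smul_apply, yonedaMu_apply, yonedaMu_apply, Finset.smul_sum]
    exact Finset.sum_congr rfl fun i _ =>
      (C.insertAll_multilinear 0 i).map_smul (Chain.cons (c i) q) t a p

theorem yonedaMu_assoc {X Y : Ob} (p : Chain A.hom X Y) (c : (i : C.Idx) → A.hom Y (C.objAt i)) :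
    (p.splits.map fun s => C.yonedaMu s.right.sgn (C.yonedaMu s.left c)).sum +
    (p.splits.map fun s => (s.right.splits.map fun t =>
      C.yonedaMu (s.left.comp (Chain.cons (A.mu t.left) t.right.sgn)) c).sum).sum = 0 := by
  have key : ∀ i : C.Idx, (p.splits.map fun t => ∑ k : C.Idx,
      C.insertAll A C.δ 0 k
        (Chain.cons (C.insertAll A C.δ 0 i (Chain.cons (c i) t.left) k) t.right.sgn)).sum +
      (p.splits.map fun s => (s.right.splits.map fun t =>
        C.insertAll A C.δ 0 i
          (Chain.cons (c i) (s.left.comp (Chain.cons (A.mu t.left) t.right.sgn)))).sum).sum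
        = 0 := by
    intro i
    have h := C.outer_add_inner i (Chain.cons (c i) p)
    rw [outerSum_cons, innerSum_cons, add_left_comm] at h
    exact add_eq_left.1 h
  have key2 := Finset.sum_eq_zero (s := Finset.univ) fun i _ => key i
  rw [Finset.sum_add_distrib, ← list_sum_comm, ← list_sum_comm] at key2
  simp only [← list_sum_comm] at key2
  refine Eq.trans ?_ key2
  refine congrArg₂ (· + ·) (congrArg List.sum (List.map_congr_left fun t _ => ?_)) rfl
  rw [Finset.sum_comm, yonedaMu_apply]
  refine Finset.sum_congr rfl fun k _ => ?_
  rw [← insertAll_cons_sum, yonedaMu_apply, Finset.sum_apply]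

/-- The image of a twisted complex under the Yoneda embedding. The value at `X` is
`hom(X, C) = ⨁_i W_i ⊗ hom(X, X_i)`, and the operations are the sums of all
`μ(δ, …, δ, c, a_d, …, a_1)` with any number of entries `δ`. -/
def yoneda : AInfModule.{u, v, v} A where
  obj X := GrVect.shiftedSum (fun i : C.Idx => A.hom X (C.objAt i)) C.wt
  mu p := C.yonedaMu p
  mu_multilinear X Y := C.yonedaMu_multilinear X Y
  mu_mem p n k c hp hc := by
    refine Submodule.sum_mem _ fun i _ => Submodule.mem_pi.2 fun j _ => ?_
    have hci := (Submodule.mem_pi.1 hc) i trivial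
    have := C.insertAll_mem i _ _ (Chain.HasRedDeg.cons hci hp) j
    convert this using 2
    ring
  assoc p c := C.yonedaMu_assoc p c
  mu_one c := C.insertAll_right_one c
  mu_insert_one q p c h := by
    refine Finset.sum_eq_zero fun i _ => ?_
    exact C.insertAll_insert_one i (Chain.cons (c i) q) p (by simp only [Chain.length]; omega)

end TwistedComplex

end

/-! Build a twisted complex `C` together with a closed morphism from its Yoneda image to `M`, and
enlarge `C` until the mapping cone of this morphism is acyclic at every object; the morphism is then
a quasi-isomorphism (`toHom_isQuasiIso`).

The morphism is encoded by a degreewise family `n i ∈ M(X_i)` with `∑ μ_M(n, δ, …, δ) = 0`. The maps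
`c ↦ ∑ μ_M(n, δ, …, δ, c, a_d, …, a_1)` then form a module homomorphism (`augMap_closed`). Such a
pair is an `AugmentedComplex`. A homogeneous cocycle `(c, x)` of the cone at `X` is exactly what is
needed to attach one more copy of `X`: `c` gives the new arrows of `δ`, and `x` the new component of
`n`. The new cone at `Y` contains the old one as a subcomplex with quotient `hom(Y, X)`. By strict
unitality, the unit of the new summand has differential `(c, x)` (`coneD_coneOne`).

Directedness makes this terminate. Objects are treated from the last to the first. At a given `X`,
the cone has finite-dimensional cohomology, because `hom(X, -)` and `H^*(M(X))` are
finite-dimensional (`exists_spanning`). Since `hom(X, X) = ℂ e`, attaching a cocycle that is not a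
boundary kills its class and creates no other (`ker_coneD_extend_le`), so finitely many steps reach
acyclicity at `X` (`exists_acyclicAt`). At every later object `Y`, `hom(Y, X) = 0`, so the cone
there does not change and stays acyclic (`AcyclicAt.extend`). -/

noncomputable section

/-! ### Morphisms from a Yoneda image to a module, given by inserting `δ`. -/

namespace TwistedComplex

variable {Ob : Type u} {A : AInfCategory.{u, v} Ob} (C : TwistedComplex A)
  {M : AInfModule.{u, v, w} A}

open FormalSum

/-- The sum of `μ_M(n, δ, …, δ, a_d, …, a_1)` with `k` entries `δ`, where `a_d` has target the
summand `i`, and `n` is a family of elements of `M` on the summands. -/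
def augWords (C : TwistedComplex A) (n : (i : C.Idx) → M.obj (C.objAt i)) {Y : Ob} :
    ℕ → (i : C.Idx) → Chain A.hom Y (C.objAt i) → M.obj Y
  | 0, i, p => M.mu p (n i)
  | k + 1, i, p => ∑ j : C.Idx, augWords C n k j
      -- The `- 0` keeps the entry in the form it has in `insertWords` at base degree `s = 0`, so
      -- that both recursions match term by term.
      (Chain.cons ((A.hom (C.objAt i) (C.objAt j)).koszul (C.wt i - 0) (C.δ i j)) p)

/-- The sum of all `μ_M(n, δ, …, δ, a_d, …, a_1)`, with any number of entries `δ`. -/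
def augAll (n : (i : C.Idx) → M.obj (C.objAt i)) {Y : Ob} (i : C.Idx)
    (p : Chain A.hom Y (C.objAt i)) : M.obj Y :=
  ∑ k ∈ Finset.range (Fintype.card C.F + 1), C.augWords n k i p

variable (n : (i : C.Idx) → M.obj (C.objAt i))

theorem augWords_multilinear {Y : Ob} (k : ℕ) (i : C.Idx) :
    Chain.IsMultilinear (C.augWords n k i : Chain A.hom Y (C.objAt i) → M.obj Y) := by
  induction k generalizing i with
  | zero =>
    refine ⟨fun q a b p => ?_, fun q t a p => ?_⟩
    · simp only [augWords, (M.mu_multilinear _ _).map_add, LinearMap.add_apply]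
    · simp only [augWords, (M.mu_multilinear _ _).map_smul, LinearMap.smul_apply]
  | succ k ih =>
    refine ⟨fun q a b p => ?_, fun q t a p => ?_⟩
    · simp only [augWords]
      rw [← Finset.sum_add_distrib]
      exact Finset.sum_congr rfl fun j _ => (ih j).map_add (Chain.cons
        ((A.hom (C.objAt i) (C.objAt j)).koszul (C.wt i - 0) (C.δ i j)) q) a b p
    · simp only [augWords]
      rw [Finset.smul_sum]
      exact Finset.sum_congr rfl fun j _ => (ih j).map_smul (Chain.cons
        ((A.hom (C.objAt i) (C.objAt j)).koszul (C.wt i - 0) (C.δ i j)) q) t a p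

theorem augAll_multilinear {Y : Ob} (i : C.Idx) :
    Chain.IsMultilinear (C.augAll n i : Chain A.hom Y (C.objAt i) → M.obj Y) := by
  refine ⟨fun q a b p => ?_, fun q t a p => ?_⟩
  · simp only [augAll]
    rw [← Finset.sum_add_distrib]
    exact Finset.sum_congr rfl fun k _ => (C.augWords_multilinear n k i).map_add q a b p
  · simp only [augAll]
    rw [Finset.smul_sum]
    exact Finset.sum_congr rfl fun k _ => (C.augWords_multilinear n k i).map_smul q t a p

/-- Every `δ` strictly lowers the level, so a nonzero word has at most as many entries `δ` as there
are summands below the starting one. -/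
theorem augWords_eq_zero {Y : Ob} (lvl : C.F → ℕ)
    (h : ∀ i j : C.Idx, ¬ lvl j.1 < lvl i.1 → C.δ i j = 0) (k : ℕ) (i : C.Idx)
    (p : Chain A.hom Y (C.objAt i))
    (hk : (Finset.univ.filter fun f => lvl f < lvl i.1).card < k) :
    C.augWords n k i p = 0 := by
  induction k generalizing i with
  | zero => omega
  | succ k ih =>
    simp only [augWords]
    refine Finset.sum_eq_zero fun j _ => ?_
    by_cases hj : lvl j.1 < lvl i.1
    · refine ih j _ (lt_of_lt_of_le (Finset.card_lt_card ?_) (Nat.lt_succ_iff.1 hk))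
      rw [Finset.ssubset_iff_of_subset]
      · exact ⟨j.1, by simp [hj], by simp⟩
      · intro f hf
        simp only [Finset.mem_filter, Finset.mem_univ, true_and] at hf ⊢
        omega
    · rw [h i j hj, map_zero]
      exact (C.augWords_multilinear n k j).map_zero Chain.nil p

theorem augWords_card {Y : Ob} (i : C.Idx) (p : Chain A.hom Y (C.objAt i)) :
    C.augWords n (Fintype.card C.F + 1) i p = 0 := by
  obtain ⟨lvl, h⟩ := C.exists_filtration
  exact C.augWords_eq_zero n lvl h _ i p (Nat.lt_succ_iff.2 (Finset.card_le_univ _))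

theorem insertWords_card (s : ℤ) {Y : Ob} (i : C.Idx) (p : Chain A.hom Y (C.objAt i)) :
    C.insertWords A C.δ s (Fintype.card C.F + 1) i p = 0 := by
  obtain ⟨lvl, h⟩ := C.exists_filtration
  exact C.insertWords_eq_zero s lvl h _ i p (Nat.lt_succ_iff.2 (Finset.card_le_univ _))

/-- Words are sorted by the entry `δ` adjacent to `p`. The truncation of the sum does no harm
because words of length `card F + 1` already vanish. -/
theorem augAll_eq {Y : Ob} (i : C.Idx) (p : Chain A.hom Y (C.objAt i)) :
    C.augAll n i p = M.mu p (n i) + ∑ j : C.Idx, C.augAll n j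
        (Chain.cons ((A.hom (C.objAt i) (C.objAt j)).koszul (C.wt i - 0) (C.δ i j)) p) := by
  have h1 : C.augAll n i p =
      ∑ k ∈ Finset.range (Fintype.card C.F + 1 + 1), C.augWords n k i p := by
    rw [Finset.sum_range_succ, C.augWords_card n, add_zero]
    rfl
  rw [h1, Finset.sum_range_succ', add_comm]
  congr 1
  simp only [augWords, augAll]
  rw [Finset.sum_comm]

theorem augWords_mem (hn : ∀ i, n i ∈ (M.obj (C.objAt i)).gr (C.wt i)) {Y : Ob} (k : ℕ)
    (i : C.Idx) (p : Chain A.hom Y (C.objAt i)) (l : ℤ) (hp : p.HasRedDeg l) :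
    C.augWords n k i p ∈ (M.obj Y).gr (C.wt i + l + 1) := by
  induction k generalizing i l with
  | zero => exact M.mu_mem p l _ _ hp (hn i)
  | succ k ih =>
    simp only [augWords]
    refine Submodule.sum_mem _ fun j _ => ?_
    have hd : (A.hom (C.objAt i) (C.objAt j)).koszul (C.wt i - 0) (C.δ i j) ∈
        (A.hom (C.objAt i) (C.objAt j)).gr (1 + C.wt i - C.wt j) := by
      rw [GrVect.koszul_apply _ _ _ _ (C.δ_mem i j)]
      exact Submodule.smul_mem _ _ (C.δ_mem i j)
    have := ih j _ _ (Chain.HasRedDeg.cons hd hp)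
    convert this using 2
    ring

theorem augAll_mem (hn : ∀ i, n i ∈ (M.obj (C.objAt i)).gr (C.wt i)) {Y : Ob}
    (i : C.Idx) (p : Chain A.hom Y (C.objAt i)) (l : ℤ) (hp : p.HasRedDeg l) :
    C.augAll n i p ∈ (M.obj Y).gr (C.wt i + l + 1) :=
  Submodule.sum_mem _ fun k _ => C.augWords_mem n hn k i p l hp

theorem augAll_insert_one {X Y : Ob} (i : C.Idx) (q : Chain A.hom Y (C.objAt i))
    (p : Chain A.hom X Y) (h : 1 ≤ q.length + p.length) :
    C.augAll n i (q.comp (Chain.cons (A.one Y) p)) = 0 := by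
  simp only [augAll]
  refine Finset.sum_eq_zero fun k hk => ?_
  clear hk
  induction k generalizing i with
  | zero => exact M.mu_insert_one q p _ h
  | succ k ih =>
    simp only [augWords]
    refine Finset.sum_eq_zero fun j _ => ?_
    exact ih j (Chain.cons ((A.hom (C.objAt i) (C.objAt j)).koszul (C.wt i - 0) (C.δ i j)) q)
      (by simp only [Chain.length]; omega)

theorem augAll_cons_zero {U Y : Ob} (j : C.Idx) (p : Chain A.hom Y U) :
    C.augAll n j (Chain.cons (0 : A.hom U (C.objAt j)) p) = 0 :=
  (C.augAll_multilinear n j).map_zero Chain.nil p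

theorem augAll_cons_sum {ι : Type*} (I : Finset ι) {U Y : Ob} (j : C.Idx)
    (f : ι → A.hom U (C.objAt j)) (p : Chain A.hom Y U) :
    C.augAll n j (Chain.cons (∑ i ∈ I, f i) p) =
      ∑ i ∈ I, C.augAll n j (Chain.cons (f i) p) :=
  map_sum ((C.augAll_multilinear n j).toLinear Chain.nil p) f I

theorem augAll_cons_add {U Y : Ob} (j : C.Idx)
    (a b : A.hom U (C.objAt j)) (p : Chain A.hom Y U) :
    C.augAll n j (Chain.cons (a + b) p) =
      C.augAll n j (Chain.cons a p) + C.augAll n j (Chain.cons b p) :=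
  (C.augAll_multilinear n j).map_add Chain.nil a b p

/-- The augmentation applied after an operation involving the leftmost entries. -/
def augOuter {Y : Ob} (i : C.Idx) (p : Chain A.hom Y (C.objAt i)) : M.obj Y :=
  (p.splits.map fun t => ∑ k : C.Idx,
    C.augAll n k (Chain.cons (C.insertAll A C.δ 0 i t.left k) t.right.sgn)).sum

/-- The operations of the module applied after the augmentation. -/
def augModule {Y : Ob} (i : C.Idx) (p : Chain A.hom Y (C.objAt i)) : M.obj Y :=
  (p.splits.map fun t => M.mu t.right.sgn (C.augAll n i t.left)).sum

/-- The augmentation applied after an operation in the given category. -/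
def augInner {Y : Ob} (i : C.Idx) (p : Chain A.hom Y (C.objAt i)) : M.obj Y :=
  (p.splits.map fun s => (s.right.splits.map fun t =>
    C.augAll n i (s.left.comp (Chain.cons (A.mu t.left) t.right.sgn))).sum).sum

/-- The part of the previous sum where the inner operation involves the leftmost entries. -/
def augLeft {Y : Ob} (i : C.Idx) (p : Chain A.hom Y (C.objAt i)) : M.obj Y :=
  (p.splits.map fun t => C.augAll n i (Chain.cons (A.mu t.left) t.right.sgn)).sum

theorem augOuter_cons {U Y : Ob} (j : C.Idx) (a : A.hom U (C.objAt j)) (p : Chain A.hom Y U) :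
    C.augOuter n j (Chain.cons a p) = (p.splits.map fun t => ∑ k : C.Idx,
      C.augAll n k
        (Chain.cons (C.insertAll A C.δ 0 j (Chain.cons a t.left) k) t.right.sgn)).sum := by
  simp only [augOuter, Chain.splits, List.map_cons, List.sum_cons, List.map_map]
  rw [Finset.sum_eq_zero, zero_add]
  · rfl
  · intro k _
    rw [C.insertAll_nil j]
    exact C.augAll_cons_zero n k _

theorem augModule_cons (hn : ∀ i, C.augAll n i Chain.nil = 0) {U Y : Ob} (j : C.Idx)
    (a : A.hom U (C.objAt j)) (p : Chain A.hom Y U) :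
    C.augModule n j (Chain.cons a p) = (p.splits.map fun t =>
      M.mu t.right.sgn (C.augAll n j (Chain.cons a t.left))).sum := by
  simp only [augModule, Chain.splits, List.map_cons, List.sum_cons, List.map_map]
  rw [hn j, map_zero, zero_add]
  rfl

theorem augInner_cons {U Y : Ob} (j : C.Idx) (a : A.hom U (C.objAt j)) (p : Chain A.hom Y U) :
    C.augInner n j (Chain.cons a p) = C.augLeft n j (Chain.cons a p) +
      (p.splits.map fun s => (s.right.splits.map fun t =>
        C.augAll n j
          (Chain.cons a (s.left.comp (Chain.cons (A.mu t.left) t.right.sgn)))).sum).sum := by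
  simp only [augInner]
  rw [Chain.splits]
  simp only [List.map_cons, List.sum_cons, List.map_map]
  rfl

/-- The module equation for `(n, δ, …, δ, p)`, summed over all words in `δ`. Inner operations on
entries `δ` alone cancel by Maurer-Cartan, and those on `n` and entries `δ` alone by `hn`. An inner
operation on leftmost entries of `p` without any `δ` is counted in both `augOuter` and `augInner`,
which leaves one copy, `augLeft`. The induction is on the filtration level, peeling off the `δ` next
to `p`. -/
theorem augOuter_add_augModule_add_augInner (hn : ∀ i, C.augAll n i Chain.nil = 0) {Y : Ob}
    (i : C.Idx) (p : Chain A.hom Y (C.objAt i)) :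
    C.augOuter n i p + C.augModule n i p + C.augInner n i p = C.augLeft n i p := by
  classical
  obtain ⟨lvl, h⟩ := C.exists_filtration
  induction hl : lvl i.1 using Nat.strong_induction_on generalizing i with
  | _ l ih =>
  subst hl
  let δ' : (j : C.Idx) → A.hom (C.objAt i) (C.objAt j) :=
    fun j => (A.hom (C.objAt i) (C.objAt j)).koszul (C.wt i - 0) (C.δ i j)
  -- Expanding the inner `insertAll`, its term without `δ` produces `augLeft`, and the others begin
  -- with `δ' j`.
  have hS : C.augOuter n i p = C.augLeft n i p + ∑ j, C.augOuter n j (Chain.cons (δ' j) p) := by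
    simp only [augOuter_cons]
    rw [← list_sum_comm]
    simp only [augOuter, augLeft]
    rw [← List.sum_map_add]
    congr 1
    refine List.map_congr_left fun t _ => ?_
    rw [Finset.sum_comm]
    simp only [← augAll_cons_sum]
    have e : ∀ k : C.Idx, C.augAll n k
          (Chain.cons (C.insertAll A C.δ 0 i t.left k) t.right.sgn) =
        C.augAll n k (Chain.cons
          ((Pi.single i (A.mu t.left) : (j : C.Idx) → A.hom t.mid (C.objAt j)) k) t.right.sgn) +
        C.augAll n k (Chain.cons
          (∑ j, C.insertAll A C.δ 0 j (Chain.cons (δ' j) t.left) k) t.right.sgn) := by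
      intro k
      rw [← augAll_cons_add]
      congr 2
      rw [C.insertAll_eq 0 i, Pi.add_apply, Finset.sum_apply]
    rw [Finset.sum_congr rfl fun k _ => e k, Finset.sum_add_distrib]
    congr 1
    rw [Finset.sum_eq_single i]
    · rw [Pi.single_eq_same]
    · intro k _ hk
      rw [Pi.single_eq_of_ne hk]
      exact C.augAll_cons_zero n k _
    · simp
  have hN : C.augModule n i p = (p.splits.map fun t => M.mu t.right.sgn (M.mu t.left (n i))).sum +
      ∑ j, C.augModule n j (Chain.cons (δ' j) p) := by
    simp only [C.augModule_cons n hn]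
    rw [← list_sum_comm]
    simp only [augModule]
    rw [← List.sum_map_add]
    congr 1
    refine List.map_congr_left fun t _ => ?_
    rw [C.augAll_eq n i, map_add, map_sum]
  have hB : C.augInner n i p = (p.splits.map fun s => (s.right.splits.map fun t =>
        M.mu (s.left.comp (Chain.cons (A.mu t.left) t.right.sgn)) (n i)).sum).sum +
      ∑ j, (C.augInner n j (Chain.cons (δ' j) p) - C.augLeft n j (Chain.cons (δ' j) p)) := by
    simp only [augInner_cons, add_sub_cancel_left]
    rw [← list_sum_comm]
    simp only [← list_sum_comm]
    rw [← List.sum_map_add]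
    simp only [augInner]
    congr 1
    refine List.map_congr_left fun s _ => ?_
    rw [← List.sum_map_add]
    congr 1
    refine List.map_congr_left fun t _ => ?_
    exact C.augAll_eq n i _
  -- The contribution of words beginning with `δ' j`: the inductive hypothesis applies if `j` has
  -- lower level, and otherwise `δ' j = 0`. What remains is the equation `M.assoc` for `n i`.
  have hz : ∀ j, C.augOuter n j (Chain.cons (δ' j) p) + C.augModule n j (Chain.cons (δ' j) p) +
      (C.augInner n j (Chain.cons (δ' j) p) - C.augLeft n j (Chain.cons (δ' j) p)) = 0 := by
    intro j
    by_cases hj : lvl j.1 < lvl i.1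
    · rw [← add_sub_assoc, ih _ hj j _ rfl, sub_self]
    · have hz : δ' j = 0 := by
        simp only [δ', h i j hj, map_zero]
      rw [hz, augInner_cons, add_sub_cancel_left, augOuter_cons, C.augModule_cons n hn]
      rw [list_sum_zero, list_sum_zero, list_sum_zero, add_zero, add_zero]
      · intro s
        exact list_sum_zero _ _ fun t => C.augAll_cons_zero n j _
      · intro t
        rw [C.augAll_cons_zero n j, map_zero]
      · intro t
        refine Finset.sum_eq_zero fun k _ => ?_
        rw [C.insertAll_cons_zero j]
        exact C.augAll_cons_zero n k _
  have hz' := Finset.sum_eq_zero (s := Finset.univ) fun j _ => hz j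
  rw [Finset.sum_add_distrib, Finset.sum_add_distrib] at hz'
  have ha := M.assoc p (n i)
  rw [hS, hN, hB]
  have hsum := congrArg₂ (· + ·) hz' ha
  simp only [add_zero] at hsum
  refine Eq.trans ?_ (add_zero _)
  rw [← hsum]
  abel

/-- The linear map which takes `c` to the sum of all `μ_M(n, δ, …, δ, c, a_d, …, a_1)`. -/
def augMap {X Y : Ob} (p : Chain A.hom X Y) :
    ((i : C.Idx) → A.hom Y (C.objAt i)) →ₗ[ℂ] M.obj X where
  toFun c := ∑ i : C.Idx, C.augAll n i (Chain.cons (c i) p)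
  map_add' c c' := by
    rw [← Finset.sum_add_distrib]
    exact Finset.sum_congr rfl fun i _ => C.augAll_cons_add n i (c i) (c' i) p
  map_smul' t c := by
    rw [RingHom.id_apply, Finset.smul_sum]
    exact Finset.sum_congr rfl fun i _ =>
      (C.augAll_multilinear n i).map_smul Chain.nil t (c i) p

theorem augMap_apply {X Y : Ob} (p : Chain A.hom X Y) (c : (i : C.Idx) → A.hom Y (C.objAt i)) :
    C.augMap n p c = ∑ i : C.Idx, C.augAll n i (Chain.cons (c i) p) := rfl

theorem augMap_multilinear (X Y : Ob) :
    Chain.IsMultilinear (C.augMap n : Chain A.hom X Y → _) := by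
  refine ⟨fun q a b p => ?_, fun q t a p => ?_⟩
  · refine LinearMap.ext fun c => ?_
    rw [LinearMap.add_apply, augMap_apply, augMap_apply, augMap_apply, ← Finset.sum_add_distrib]
    exact Finset.sum_congr rfl fun i _ =>
      (C.augAll_multilinear n i).map_add (Chain.cons (c i) q) a b p
  · refine LinearMap.ext fun c => ?_
    rw [LinearMap.smul_apply, augMap_apply, augMap_apply, Finset.smul_sum]
    exact Finset.sum_congr rfl fun i _ =>
      (C.augAll_multilinear n i).map_smul (Chain.cons (c i) q) t a p

/-- The previous identity for the sequence `(c i, a_d, …, a_1)`, summed over `i`; the terms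
`augLeft` on its two sides cancel. -/
theorem augMap_closed (hn : ∀ i, C.augAll n i Chain.nil = 0) {X Y : Ob} (p : Chain A.hom X Y)
    (c : (i : C.Idx) → A.hom Y (C.objAt i)) :
    (p.splits.map fun s => M.mu s.right.sgn (C.augMap n s.left c)).sum +
    (p.splits.map fun s => C.augMap n s.right.sgn (C.yonedaMu s.left c)).sum +
    (p.splits.map fun s => (s.right.splits.map fun t =>
      C.augMap n (s.left.comp (Chain.cons (A.mu t.left) t.right.sgn)) c).sum).sum = 0 := by
  have key : ∀ i : C.Idx,
      (p.splits.map fun t => M.mu t.right.sgn (C.augAll n i (Chain.cons (c i) t.left))).sum +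
      (p.splits.map fun t => ∑ k : C.Idx, C.augAll n k
        (Chain.cons (C.insertAll A C.δ 0 i (Chain.cons (c i) t.left) k) t.right.sgn)).sum +
      (p.splits.map fun s => (s.right.splits.map fun t =>
        C.augAll n i
          (Chain.cons (c i) (s.left.comp (Chain.cons (A.mu t.left) t.right.sgn)))).sum).sum
        = 0 := by
    intro i
    have h := C.augOuter_add_augModule_add_augInner n hn i (Chain.cons (c i) p)
    rw [augOuter_cons, augInner_cons, C.augModule_cons n hn, add_left_comm] at h
    rw [add_comm (List.sum _) (List.sum _)]
    exact add_eq_left.1 h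
  have key2 := Finset.sum_eq_zero (s := Finset.univ) fun i _ => key i
  rw [Finset.sum_add_distrib, Finset.sum_add_distrib, ← list_sum_comm, ← list_sum_comm,
    ← list_sum_comm] at key2
  simp only [← list_sum_comm] at key2
  refine Eq.trans ?_ key2
  refine congrArg₂ (· + ·) (congrArg₂ (· + ·) ?_ ?_) rfl
  · refine congrArg List.sum (List.map_congr_left fun t _ => ?_)
    rw [augMap_apply, map_sum]
  · refine congrArg List.sum (List.map_congr_left fun t _ => ?_)
    rw [Finset.sum_comm, augMap_apply]
    refine Finset.sum_congr rfl fun k _ => ?_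
    rw [← augAll_cons_sum, yonedaMu_apply, Finset.sum_apply]

end TwistedComplex

/-! ### Augmented complexes. -/

/-- A twisted complex together with a closed morphism, of the form `μ_M(n, δ, …, δ, ·)`, from its
Yoneda image to `M`. -/
structure AugmentedComplex {Ob : Type u} {A : AInfCategory.{u, v} Ob}
    (M : AInfModule.{u, v, w} A) extends TwistedComplex A where
  n : (i : toFormalSum.Idx) → M.obj (toFormalSum.objAt i)
  n_mem : ∀ i, n i ∈ (M.obj (toFormalSum.objAt i)).gr (toFormalSum.wt i)
  closed : ∀ i, toTwistedComplex.augAll n i Chain.nil = 0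

namespace AugmentedComplex

variable {Ob : Type u} {A : AInfCategory.{u, v} Ob} {M : AInfModule.{u, v, w} A}

/-- The module homomorphism defined by an augmented complex. -/
def toHom (C : AugmentedComplex M) : C.toTwistedComplex.yoneda.Hom M where
  map p := C.augMap C.n p
  map_multilinear X Y := C.augMap_multilinear C.n X Y
  map_mem p l k c hp hc := by
    refine Submodule.sum_mem _ fun i _ => ?_
    have hci := (Submodule.mem_pi.1 hc) i trivial
    have := C.augAll_mem C.n C.n_mem i _ _ (Chain.HasRedDeg.cons hci hp)
    convert this using 2
    ring
  closed p c := C.augMap_closed C.n C.closed p c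

end AugmentedComplex

/-! ### Adjoining one summand to a formal sum. -/

namespace FormalSum

variable {Ob : Type u}

/-- Add a one-dimensional summand in degree `q` with object `X`. -/
def extend (C : FormalSum Ob) (X : Ob) (q : ℤ) : FormalSum Ob where
  F := Option C.F
  K := fun f => f.elim Unit C.K
  fintypeK := fun f => match f with
    | none => inferInstanceAs (Fintype Unit)
    | some f => C.fintypeK f
  deg := fun f => match f with
    | none => fun _ => q
    | some f => C.deg f
  X := fun f => f.elim X C.X

variable (C : FormalSum Ob) (X : Ob) (q : ℤ)

/-- The new index of an extended formal sum. -/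
def newIdx : (C.extend X q).Idx := ⟨(none : Option C.F), ()⟩

/-- The indices of an extended formal sum which come from the original one. -/
def oldIdx (i : C.Idx) : (C.extend X q).Idx := ⟨(some i.1 : Option C.F), i.2⟩

variable {C X q} in
theorem extend_cases {P : (C.extend X q).Idx → Prop} (h₀ : P (C.newIdx X q))
    (h : ∀ i, P (C.oldIdx X q i)) : ∀ i, P i
  | ⟨none, ()⟩ => h₀
  | ⟨some f, a⟩ => h ⟨f, a⟩

theorem card_extend : Fintype.card (C.extend X q).F = Fintype.card C.F + 1 :=
  Fintype.card_option (α := C.F)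

theorem sum_extend {V : Type*} [AddCommMonoid V] (g : (C.extend X q).Idx → V) :
    ∑ i, g i = g (C.newIdx X q) + ∑ i, g (C.oldIdx X q i) := by
  rw [Fintype.sum_sigma, Fintype.sum_sigma]
  refine (Fintype.sum_option (α := C.F) _).trans ?_
  refine congrArg₂ (· + ·) ?_ rfl
  exact Fintype.sum_unique (ι := Unit) _

theorem oldIdx_injective : Function.Injective (C.oldIdx X q) := by
  rintro ⟨f, a⟩ ⟨g, b⟩ h
  obtain ⟨h₁, h₂⟩ := Sigma.mk.inj h
  exact Sigma.ext (Option.some.inj h₁) h₂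

theorem newIdx_ne_oldIdx (i : C.Idx) : C.newIdx X q ≠ C.oldIdx X q i := by
  intro h
  exact Option.noConfusion rfl (heq_of_eq (congrArg Sigma.fst h))

variable {C X q} {A : AInfCategory.{u, v} Ob}

theorem insertWords_zero_same (δ : C.End A) (s : ℤ) {Y : Ob} (i : C.Idx)
    (p : Chain A.hom Y (C.objAt i)) : C.insertWords A δ s 0 i p i = A.mu p := by
  classical
  rw [insertWords]
  exact Pi.single_eq_same _ _

theorem insertWords_zero_of_ne (δ : C.End A) (s : ℤ) {Y : Ob} {i j : C.Idx} (h : j ≠ i)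
    (p : Chain A.hom Y (C.objAt i)) : C.insertWords A δ s 0 i p j = 0 := by
  classical
  rw [insertWords]
  exact Pi.single_eq_of_ne h _

/-- Extend a matrix by the coefficients of a morphism from the new summand. -/
def extendEnd (δ : C.End A) (q : ℤ) (c : (j : C.Idx) → A.hom X (C.objAt j)) :
    (C.extend X q).End A
  -- The sign cancels the one which `insertWords` at base degree `0` gives to an arrow leaving a
  -- summand of degree `q`, so that `c` itself appears in the words.
  | ⟨none, _⟩, ⟨some g, b⟩ => (A.hom X (C.X g)).koszul q (c ⟨g, b⟩)
  | ⟨some f, a⟩, ⟨some g, b⟩ => δ ⟨f, a⟩ ⟨g, b⟩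
  | ⟨none, _⟩, ⟨none, _⟩ => 0
  | ⟨some _, _⟩, ⟨none, _⟩ => 0

/-- Needed for an arbitrary matrix, because it is applied to `extendEnd` before that is known to
define a twisted complex. -/
theorem insertWords_cons_zero (δ : C.End A) (s : ℤ) {Y Z : Ob} (k : ℕ) (i : C.Idx)
    (q : Chain A.hom Z (C.objAt i)) (p : Chain A.hom Y X) :
    C.insertWords A δ s k i (q.comp (Chain.cons (0 : A.hom X Z) p)) = 0 := by
  classical
  induction k generalizing i with
  | zero => rw [insertWords, (A.mu_multilinear _ _).map_zero, Pi.single_zero]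
  | succ k ih =>
    rw [insertWords]
    exact Finset.sum_eq_zero fun j _ => ih j
      (Chain.cons ((A.hom (C.objAt i) (C.objAt j)).koszul (C.wt i - s) (δ i j)) q)

variable (C : TwistedComplex A) (q) (c : (j : C.Idx) → A.hom X (C.objAt j))

/-- No arrow leads from an old summand to the new one, so words starting at an old summand never
leave the old complex. -/
theorem insertWords_extend_old (s : ℤ) {Y : Ob} (k : ℕ) (i : C.Idx)
    (p : Chain A.hom Y (C.objAt i)) :
    (C.extend X q).insertWords A (extendEnd C.δ q c) s k (C.oldIdx X q i) p (C.newIdx X q) = 0 ∧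
    ∀ j, (C.extend X q).insertWords A (extendEnd C.δ q c) s k (C.oldIdx X q i) p
      (C.oldIdx X q j) = C.insertWords A C.δ s k i p j := by
  induction k generalizing i with
  | zero =>
    refine ⟨insertWords_zero_of_ne _ s (C.newIdx_ne_oldIdx X q i) p, fun j => ?_⟩
    by_cases h : j = i
    · subst h
      rw [insertWords_zero_same]
      exact insertWords_zero_same (C := C.extend X q) _ s (C.oldIdx X q j) p
    · rw [insertWords_zero_of_ne _ s h]
      exact insertWords_zero_of_ne _ s (fun h' => h (C.oldIdx_injective X q h')) p
  | succ k ih =>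
    have h₀ : ∀ j, (C.extend X q).insertWords A (extendEnd C.δ q c) s k (C.newIdx X q)
        (Chain.cons ((A.hom (C.objAt i) X).koszul (C.wt i - s) 0) p) j = 0 := by
      intro j
      rw [map_zero]
      exact congrFun (insertWords_cons_zero _ s k (C.newIdx X q) Chain.nil p) j
    refine ⟨?_, fun j => ?_⟩
    · simp only [insertWords, Finset.sum_apply]
      rw [sum_extend]
      refine (congrArg₂ (· + ·) (h₀ _) (Finset.sum_eq_zero fun l _ => (ih l _).1)).trans
        (add_zero _)
    · simp only [insertWords, Finset.sum_apply]
      rw [sum_extend]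
      refine (congrArg₂ (· + ·) (h₀ _) (Finset.sum_congr rfl fun l _ => (ih l _).2 j)).trans
        (zero_add _)

theorem insertAll_extend_old (s : ℤ) {Y : Ob} (i : C.Idx) (p : Chain A.hom Y (C.objAt i)) :
    (C.extend X q).insertAll A (extendEnd C.δ q c) s (C.oldIdx X q i) p (C.newIdx X q) = 0 ∧
    ∀ j, (C.extend X q).insertAll A (extendEnd C.δ q c) s (C.oldIdx X q i) p
      (C.oldIdx X q j) = C.insertAll A C.δ s i p j := by
  simp only [insertAll, Finset.sum_apply]
  refine ⟨Finset.sum_eq_zero fun k _ => (insertWords_extend_old q C c s k i p).1, fun j => ?_⟩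
  -- The extension has one more summand, hence one more admissible word length, whose words vanish
  -- on the old complex.
  rw [card_extend, Finset.sum_range_succ]
  refine (congrArg₂ (· + ·) (Finset.sum_congr rfl fun k _ =>
    (insertWords_extend_old q C c s k i p).2 j) ?_).trans (add_zero _)
  refine ((insertWords_extend_old q C c s _ i p).2 j).trans ?_
  rw [C.insertWords_card]
  rfl

/-- A nonempty word from the new summand takes one arrow `c` into the old complex and stays there.
The additional word length allowed by the larger `F` accounts for that first arrow. -/
theorem insertAll_extend_new (s : ℤ) {Y : Ob} (p : Chain A.hom Y X) :
    (C.extend X q).insertAll A (extendEnd C.δ q c) s (C.newIdx X q) p (C.newIdx X q) = A.mu p ∧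
    ∀ j, (C.extend X q).insertAll A (extendEnd C.δ q c) s (C.newIdx X q) p
      (C.oldIdx X q j) = ∑ i : C.Idx, C.insertAll A C.δ s i (Chain.cons
        ((A.hom X (C.objAt i)).koszul (q - s) ((A.hom X (C.objAt i)).koszul q (c i))) p) j := by
  have h₀ : ∀ k j, (C.extend X q).insertWords A (extendEnd C.δ q c) s k (C.newIdx X q)
      (Chain.cons ((A.hom X X).koszul (q - s) 0) p) j = 0 := by
    intro k j
    rw [map_zero]
    exact congrFun (insertWords_cons_zero _ s k (C.newIdx X q) Chain.nil p) j
  simp only [insertAll, Finset.sum_apply]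
  rw [card_extend, Finset.sum_range_succ']
  refine ⟨?_, fun j => ?_⟩
  · refine (congrArg₂ (· + ·) (Finset.sum_eq_zero fun k _ => ?_)
      (insertWords_zero_same (C := C.extend X q) _ s (C.newIdx X q) p)).trans (zero_add _)
    simp only [insertWords, Finset.sum_apply]
    rw [sum_extend]
    exact (congrArg₂ (· + ·) (h₀ k _) (Finset.sum_eq_zero fun i _ =>
      (insertWords_extend_old q C c s k i _).1)).trans (add_zero _)
  · rw [Finset.sum_range_succ']
    refine (congrArg₂ (· + ·) ?_ (insertWords_zero_of_ne _ s
      (C.newIdx_ne_oldIdx X q j).symm p)).trans (add_zero _)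
    rw [Finset.sum_comm]
    refine Finset.sum_congr rfl fun k _ => ?_
    simp only [insertWords, Finset.sum_apply]
    rw [sum_extend]
    exact (congrArg₂ (· + ·) (h₀ k _) (Finset.sum_congr rfl fun i _ =>
      (insertWords_extend_old q C c s k i _).2 j)).trans (zero_add _)

end FormalSum

theorem GrVect.koszul_koszul (V : GrVect.{v}) (m : ℤ) (n : ℤ) (a : V) (ha : a ∈ V.gr n) :
    V.koszul m (V.koszul m a) = a := by
  rw [V.koszul_apply m n a ha, map_smul, V.koszul_apply m n a ha, smul_smul, ← mul_zpow]
  norm_num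

/-! ### Cones over a single object as twisted complexes. -/

namespace TwistedComplex

open FormalSum

variable {Ob : Type u} {A : AInfCategory.{u, v} Ob} {M : AInfModule.{u, v, w} A}

theorem insertAll_shift (C : TwistedComplex A) (s : ℤ) {Y : Ob} (i : C.Idx)
    (p : Chain A.hom Y (C.objAt i)) (j : C.Idx) : C.insertAll A C.δ s i p j =
      ((-1 : ℂ) ^ (s * C.wt i - s * C.wt j)) • C.insertAll A C.δ 0 i p j := by
  simp only [insertAll, Finset.sum_apply]
  rw [Finset.smul_sum]
  exact Finset.sum_congr rfl fun k _ => C.insertWords_shift _ _ _ _ _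

theorem yonedaMu_apply_apply (C : TwistedComplex A) {X Y : Ob} (p : Chain A.hom X Y)
    (c : (i : C.Idx) → A.hom Y (C.objAt i)) (j : C.Idx) :
    C.yonedaMu p c j = ∑ i : C.Idx, C.insertAll A C.δ 0 i (Chain.cons (c i) p) j :=
  Finset.sum_apply _ _ _

/-- The mapping cone of a closed morphism from an object `X` to a twisted complex. -/
def extend (C : TwistedComplex A) {X : Ob} (q : ℤ) (c : (j : C.Idx) → A.hom X (C.objAt j))
    (hc : ∀ j, c j ∈ (A.hom X (C.objAt j)).gr (1 + q - C.wt j))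
    (hd : C.yonedaMu Chain.nil c = 0) : TwistedComplex A where
  toFormalSum := C.toFormalSum.extend X q
  δ := extendEnd C.δ q c
  δ_mem := by
    refine extend_cases ?_ fun i => ?_
    · refine extend_cases (Submodule.zero_mem _) fun j => ?_
      have : (A.hom X (C.objAt j)).koszul q (c j) ∈
          (A.hom X (C.objAt j)).gr (1 + q - C.wt j) := by
        rw [GrVect.koszul_apply _ _ _ _ (hc j)]
        exact Submodule.smul_mem _ _ (hc j)
      exact this
    · exact extend_cases (Submodule.zero_mem _) fun j => C.δ_mem i j
  exists_filtration := by
    obtain ⟨lvl, h⟩ := C.exists_filtration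
    -- The new summand gets a level above all old ones.
    refine ⟨fun f : Option C.F => f.elim (1 + ∑ g, lvl g) lvl, ?_⟩
    refine extend_cases ?_ fun i => ?_
    · refine extend_cases (fun _ => rfl) fun j hj => absurd ?_ hj
      have : lvl j.1 ≤ ∑ g, lvl g :=
        Finset.single_le_sum (f := lvl) (fun _ _ => Nat.zero_le _) (Finset.mem_univ j.1)
      show lvl j.1 < 1 + ∑ g, lvl g
      omega
    · exact extend_cases (fun _ => rfl) fun j hj => h i j hj
  maurerCartan := by
    refine extend_cases ?_ fun i => ?_
    · obtain ⟨h₁, h₂⟩ := insertAll_extend_new q C c q (Chain.nil : Chain A.hom X X)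
      refine funext (extend_cases (h₁.trans (A.mu_nil X)) fun j => (h₂ j).trans ?_)
      -- The sign of `koszul q` and that of passing from base degree `q` to `0` combine to one
      -- independent of `i`. The Maurer-Cartan sum is therefore a multiple of `yonedaMu Chain.nil
      -- c`, which is zero by `hd`.
      have e : ∀ i, C.insertAll A C.δ q i (Chain.cons ((A.hom X (C.objAt i)).koszul (q - q)
          ((A.hom X (C.objAt i)).koszul q (c i))) Chain.nil) j =
          ((-1 : ℂ) ^ (q * q - q * C.wt j)) •
            C.insertAll A C.δ 0 i (Chain.cons (c i) Chain.nil) j := by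
        intro i
        have := (C.insertAll_multilinear 0 i).map_smul Chain.nil
          ((-1 : ℂ) ^ (q * (1 + q - C.wt i - 1))) (c i) (Chain.nil : Chain A.hom X X)
        simp only [Chain.comp] at this
        rw [sub_self, GrVect.koszul_zero, GrVect.koszul_apply _ _ _ _ (hc i), insertAll_shift,
          this, Pi.smul_apply, smul_smul, ← zpow_add₀ (by norm_num : (-1 : ℂ) ≠ 0)]
        congr 2
        ring
      rw [Finset.sum_congr rfl fun i _ => e i, ← Finset.smul_sum]
      have := congrFun hd j
      rw [yonedaMu_apply, Finset.sum_apply] at this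
      refine (congrArg _ this).trans ?_
      exact smul_zero (A := A.hom X (C.objAt j)) _
    · obtain ⟨h₁, h₂⟩ := insertAll_extend_old q C c (C.wt i) i Chain.nil
      exact funext (extend_cases h₁ fun j => (h₂ j).trans (congrFun (C.maurerCartan i) j))

variable (C : TwistedComplex A) {X : Ob} (q : ℤ) (c : (j : C.Idx) → A.hom X (C.objAt j))
    (hc : ∀ j, c j ∈ (A.hom X (C.objAt j)).gr (1 + q - C.wt j))
    (hd : C.yonedaMu Chain.nil c = 0)

/-- Extend a family indexed by a formal sum to the mapping cone. -/
def extendFamily {V : Ob → Type*} (x : V X) (n : (i : C.Idx) → V (C.objAt i)) :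
    (i : (C.toFormalSum.extend X q).Idx) → V ((C.toFormalSum.extend X q).objAt i)
  | ⟨none, _⟩ => x
  | ⟨some f, a⟩ => n ⟨f, a⟩

variable (x : M.obj X) (n : (i : C.Idx) → M.obj (C.objAt i))

theorem augWords_extend_old {Y : Ob} (k : ℕ) (i : C.Idx) (p : Chain A.hom Y (C.objAt i)) :
    (C.extend q c hc hd).augWords (C.extendFamily q (V := fun Y => M.obj Y) x n) k
      (C.oldIdx X q i) p = C.augWords n k i p := by
  induction k generalizing i with
  | zero => rfl
  | succ k ih =>
    simp only [augWords]
    refine (sum_extend _ _ _ _).trans ?_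
    refine (congrArg₂ (· + ·) ?_ (Finset.sum_congr rfl fun l _ => ih l _)).trans (zero_add _)
    have : (A.hom (C.objAt i) X).koszul (C.wt i - 0) 0 = 0 := map_zero _
    exact (congrArg (fun a : A.hom (C.objAt i) X => (C.extend q c hc hd).augWords
      (C.extendFamily q (V := fun Y => M.obj Y) x n) k (C.newIdx X q) (Chain.cons a p)) this).trans
      (((C.extend q c hc hd).augWords_multilinear
      (C.extendFamily q (V := fun Y => M.obj Y) x n) k (C.newIdx X q)).map_zero Chain.nil p)

theorem augAll_extend_old {Y : Ob} (i : C.Idx) (p : Chain A.hom Y (C.objAt i)) :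
    (C.extend q c hc hd).augAll (C.extendFamily q (V := fun Y => M.obj Y) x n)
      (C.oldIdx X q i) p = C.augAll n i p := by
  simp only [augAll]
  refine (congrArg (fun r => Finset.sum (Finset.range (r + 1)) _)
    (C.toFormalSum.card_extend X q)).trans ?_
  rw [Finset.sum_range_succ]
  refine (congrArg₂ (· + ·) (Finset.sum_congr rfl fun k _ =>
    C.augWords_extend_old q c hc hd x n k i p)
    ((C.augWords_extend_old q c hc hd x n _ i p).trans (C.augWords_card n i p))).trans (add_zero _)

/-- The empty word contributes `M.mu p x`; all others begin with an arrow `c`, whose two signs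
cancel. For empty `p`, this is the second component of the cone differential of `(c, x)`. -/
theorem augAll_extend_new {Y : Ob} (p : Chain A.hom Y X) :
    (C.extend q c hc hd).augAll (C.extendFamily q (V := fun Y => M.obj Y) x n)
      (C.newIdx X q) p = M.mu p x + C.augMap n p c := by
  refine ((C.extend q c hc hd).augAll_eq _ (C.newIdx X q) p).trans (congrArg₂ (· + ·) rfl ?_)
  refine (sum_extend _ _ _ _).trans ?_
  refine (congrArg₂ (· + ·) ?_ (Finset.sum_congr rfl fun l _ => ?_)).trans (zero_add _)
  · have : (A.hom X X).koszul (q - 0) 0 = 0 := map_zero _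
    exact (congrArg (fun a : A.hom X X => (C.extend q c hc hd).augAll
      (C.extendFamily q (V := fun Y => M.obj Y) x n) (C.newIdx X q) (Chain.cons a p)) this).trans
      ((C.extend q c hc hd).augAll_cons_zero
      (C.extendFamily q (V := fun Y => M.obj Y) x n) (C.newIdx X q) p)
  · refine (C.augAll_extend_old q c hc hd x n l _).trans ?_
    refine congrArg (fun a => C.augAll n l (Chain.cons a p)) ?_
    refine (congrArg (fun s => (A.hom X (C.objAt l)).koszul s
      ((A.hom X (C.objAt l)).koszul q (c l))) (sub_zero q)).trans ?_
    exact GrVect.koszul_koszul _ _ _ _ (hc l)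

end TwistedComplex

/-! ### Attaching a cone cocycle to an augmented complex. -/

namespace AugmentedComplex

open FormalSum

variable {Ob : Type u} {A : AInfCategory.{u, v} Ob} {M : AInfModule.{u, v, w} A}
  (C : AugmentedComplex M) {X : Ob} (q : ℤ) (c : (j : C.Idx) → A.hom X (C.objAt j))
  (hc : ∀ j, c j ∈ (A.hom X (C.objAt j)).gr (1 + q - C.wt j))
  (hd : C.yonedaMu Chain.nil c = 0) (x : M.obj X) (hx : x ∈ (M.obj X).gr q)
  (hdx : C.augMap C.n Chain.nil c + M.mu Chain.nil x = 0)

/-- Extend an augmented complex by a cocycle `(c, x)` of the mapping cone of its augmentation. -/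
def extend : AugmentedComplex M where
  toTwistedComplex := C.toTwistedComplex.extend q c hc hd
  n := C.toTwistedComplex.extendFamily q (V := fun Y => M.obj Y) x C.n
  n_mem := extend_cases hx C.n_mem
  closed := extend_cases
    ((C.augAll_extend_new q c hc hd x C.n Chain.nil).trans ((add_comm _ _).trans hdx))
    fun i => (C.augAll_extend_old q c hc hd x C.n i Chain.nil).trans (C.closed i)

/-- The component of `b` at the new summand reaches the old ones only through `c`, and so acts as a
further entry of the sequence applied to `c`. -/
theorem yonedaMu_extend_old {Y Z : Ob} (p : Chain A.hom Y Z)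
    (b : (i : (C.extend q c hc hd x hx hdx).Idx) →
      A.hom Z ((C.extend q c hc hd x hx hdx).objAt i)) (j : C.Idx) :
    (C.extend q c hc hd x hx hdx).yonedaMu p b (C.oldIdx X q j) =
      C.yonedaMu p (fun i => b (C.oldIdx X q i)) j +
      C.yonedaMu (Chain.cons (b (C.newIdx X q)) p) c j := by
  refine Eq.trans ?_ (add_comm _ _)
  refine ((C.extend q c hc hd x hx hdx).yonedaMu_apply_apply _ _ _).trans ?_
  refine (sum_extend _ _ _ _).trans (congrArg₂ (· + ·) ?_ ?_)
  · refine ((insertAll_extend_new q C.toTwistedComplex c 0 _).2 j).trans ?_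
    refine Eq.trans ?_ (C.yonedaMu_apply_apply _ _ j).symm
    refine Finset.sum_congr rfl fun i _ => ?_
    rw [sub_zero, GrVect.koszul_koszul _ _ _ _ (hc i)]
    rfl
  · refine Eq.trans ?_ (C.yonedaMu_apply_apply _ _ j).symm
    exact Finset.sum_congr rfl fun i _ => (insertAll_extend_old q C.toTwistedComplex c 0 i _).2 j

theorem yonedaMu_extend_new {Y Z : Ob} (p : Chain A.hom Y Z)
    (b : (i : (C.extend q c hc hd x hx hdx).Idx) →
      A.hom Z ((C.extend q c hc hd x hx hdx).objAt i)) :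
    (C.extend q c hc hd x hx hdx).yonedaMu p b (C.newIdx X q) =
      A.mu (Chain.cons (Z := X) (b (C.newIdx X q)) p) := by
  refine ((C.extend q c hc hd x hx hdx).yonedaMu_apply_apply _ _ _).trans ?_
  refine (sum_extend _ _ _ _).trans ((congrArg₂ (· + ·) ?_ ?_).trans (add_zero _))
  · exact (insertAll_extend_new q C.toTwistedComplex c 0 _).1
  · exact Finset.sum_eq_zero fun i _ => (insertAll_extend_old q C.toTwistedComplex c 0 i _).1

theorem augMap_extend {Y Z : Ob} (p : Chain A.hom Y Z)
    (b : (i : (C.extend q c hc hd x hx hdx).Idx) →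
      A.hom Z ((C.extend q c hc hd x hx hdx).objAt i)) :
    (C.extend q c hc hd x hx hdx).augMap (C.extend q c hc hd x hx hdx).n p b =
      C.augMap C.n p (fun i => b (C.oldIdx X q i)) +
      (M.mu (Chain.cons (Z := X) (b (C.newIdx X q)) p) x +
        C.augMap C.n (Chain.cons (b (C.newIdx X q)) p) c) := by
  rw [add_comm]
  refine (sum_extend _ _ _ _).trans (congrArg₂ (· + ·) ?_ ?_)
  · exact C.augAll_extend_new q c hc hd x C.n _
  · exact Finset.sum_congr rfl fun i _ => C.augAll_extend_old q c hc hd x C.n i _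

end AugmentedComplex

/-! ### Homogeneous components. -/

namespace GrVect

/-- The projection to the part of degree `n`. -/
def proj (V : GrVect.{v}) (n : ℤ) : V →ₗ[ℂ] V :=
  (V.gr n).subtype ∘ₗ DirectSum.component ℂ ℤ (fun n => V.gr n) n ∘ₗ
    (LinearEquiv.ofBijective (DirectSum.coeLinearMap V.gr) V.isInternal).symm.toLinearMap

theorem proj_mem (V : GrVect.{v}) (n : ℤ) (a : V) : V.proj n a ∈ V.gr n :=
  Subtype.property _

theorem ofBijective_symm_apply (V : GrVect.{v}) {n : ℤ} {a : V} (ha : a ∈ V.gr n) :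
    (LinearEquiv.ofBijective (DirectSum.coeLinearMap V.gr) V.isInternal).symm a =
      DirectSum.lof ℂ ℤ (fun n => V.gr n) n ⟨a, ha⟩ := by
  rw [LinearEquiv.symm_apply_eq, DirectSum.lof_eq_of]
  exact (DirectSum.coeLinearMap_of V.gr n ⟨a, ha⟩).symm

theorem proj_of_mem (V : GrVect.{v}) {n : ℤ} {a : V} (ha : a ∈ V.gr n) : V.proj n a = a := by
  simp only [proj, LinearMap.comp_apply, LinearEquiv.coe_coe, V.ofBijective_symm_apply ha,
    DirectSum.component.lof_self, Submodule.subtype_apply]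

theorem proj_of_mem_of_ne (V : GrVect.{v}) {n m : ℤ} (h : m ≠ n) {a : V} (ha : a ∈ V.gr n) :
    V.proj m a = 0 := by
  simp only [proj, LinearMap.comp_apply, LinearEquiv.coe_coe, V.ofBijective_symm_apply ha,
    DirectSum.component.of, Submodule.subtype_apply]
  rw [dif_neg h.symm]
  rfl

theorem induction_on (V : GrVect.{v}) {P : V → Prop} (a : V) (h₀ : ∀ n, ∀ a ∈ V.gr n, P a)
    (h₁ : ∀ a b, P a → P b → P (a + b)) : P a := by
  have ha : a ∈ ⨆ n, V.gr n := by
    rw [V.isInternal.submodule_iSup_eq_top]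
    trivial
  exact Submodule.iSup_induction _ (motive := P) ha h₀ (h₀ 0 0 (Submodule.zero_mem _)) h₁

/-- Used to see that the homogeneous components of a cone cocycle are again cocycles. -/
theorem map_proj {V : GrVect.{v}} {W : GrVect.{w}} (f : V →ₗ[ℂ] W) (e : ℤ)
    (hf : ∀ n, ∀ a ∈ V.gr n, f a ∈ W.gr (e + n)) (n : ℤ) (a : V) :
    f (V.proj n a) = W.proj (e + n) (f a) := by
  refine V.induction_on (P := fun a => f (V.proj n a) = W.proj (e + n) (f a)) a
    (fun m a ha => ?_) fun a b ha hb => ?_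
  · by_cases h : n = m
    · subst h
      rw [V.proj_of_mem ha, W.proj_of_mem (hf n a ha)]
    · rw [V.proj_of_mem_of_ne h ha, W.proj_of_mem_of_ne (fun h' => h (add_left_cancel h'))
        (hf m a ha), map_zero]
  · simp only [map_add, ha, hb]

/-- Allowing every larger `t` makes it possible to decompose both components of a cone element over
one common index set. -/
theorem exists_sum_proj (V : GrVect.{v}) (a : V) :
    ∃ s : Finset ℤ, ∀ t, s ⊆ t → ∑ n ∈ t, V.proj n a = a := by
  classical
  refine V.induction_on (P := fun a => ∃ s : Finset ℤ, ∀ t, s ⊆ t → ∑ n ∈ t, V.proj n a = a) a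
    (fun m a ha => ⟨{m}, fun t ht => ?_⟩) ?_
  · rw [Finset.sum_eq_single m (fun n _ h => V.proj_of_mem_of_ne h ha)
      fun h => absurd (ht (Finset.mem_singleton_self m)) h, V.proj_of_mem ha]
  · rintro a b ⟨s, hs⟩ ⟨s', hs'⟩
    refine ⟨s ∪ s', fun t ht => ?_⟩
    simp only [map_add]
    rw [Finset.sum_add_distrib, hs t (Finset.union_subset_left ht),
      hs' t (Finset.union_subset_right ht)]

end GrVect

/-! ### Finiteness of the cohomology of a cone, as linear algebra. -/

/-- This replaces arbitrary generators of the cone cohomology by finitely many homogeneous cocycles.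
-/
theorem Submodule.FG.exists_finset_span {V : Type*} [AddCommGroup V] [Module ℂ V]
    {P : Submodule ℂ V} (hP : P.FG) {H : Set V} (h : P ≤ Submodule.span ℂ H) :
    ∃ t : Finset V, ↑t ⊆ H ∧ P ≤ Submodule.span ℂ (t : Set V) := by
  classical
  obtain ⟨T, rfl⟩ := hP
  have key : ∀ a : T, ∃ t : Finset V, ↑t ⊆ H ∧ (a : V) ∈ Submodule.span ℂ (t : Set V) :=
    fun a => Submodule.mem_span_finite_of_mem_span (h (Submodule.subset_span a.2))
  choose t ht ha using key
  refine ⟨Finset.univ.biUnion t, ?_, Submodule.span_le.2 fun a ha' => ?_⟩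
  · simpa using ht
  · refine Submodule.span_mono ?_ (ha ⟨a, ha'⟩)
    exact_mod_cast Finset.subset_biUnion_of_mem t (Finset.mem_univ (⟨a, ha'⟩ : T))

/-- If the quotient of `ker d` by `im d`, and `V`, are finite-dimensional, then so is the cohomology
of a mapping cone. -/
theorem exists_fg_cone {V W : Type*} [AddCommGroup V] [Module ℂ V] [AddCommGroup W] [Module ℂ W]
    [FiniteDimensional ℂ V] (d : W →ₗ[ℂ] W) (D : V × W →ₗ[ℂ] V × W)
    (hD : ∀ x, D (0, x) = (0, d x))
    (h : FiniteDimensional ℂ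
      (LinearMap.ker d ⧸ (LinearMap.range d).submoduleOf (LinearMap.ker d))) :
    ∃ P : Submodule ℂ (V × W), P.FG ∧ P ≤ LinearMap.ker D ∧
      LinearMap.ker D ≤ P ⊔ LinearMap.range D := by
  -- A cocycle of `D` is determined by its image in the finite-dimensional `V` up to a cocycle `(0,
  -- w)` with `d w = 0`. So `P` is spanned by lifts `g` of the image of `f` and by representatives
  -- `g'` of the cohomology of `d`.
  let f : LinearMap.ker D →ₗ[ℂ] V := LinearMap.fst ℂ V W ∘ₗ (LinearMap.ker D).subtype
  obtain ⟨g, hg⟩ := f.rangeRestrict.exists_rightInverse_of_surjective f.range_rangeRestrict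
  let N := (LinearMap.range d).submoduleOf (LinearMap.ker d)
  obtain ⟨g', hg'⟩ := N.mkQ.exists_rightInverse_of_surjective N.range_mkQ
  let k : (LinearMap.ker d ⧸ N) →ₗ[ℂ] V × W :=
    LinearMap.inr ℂ V W ∘ₗ (LinearMap.ker d).subtype ∘ₗ g'
  have hk : ∀ y, k y ∈ LinearMap.ker D := fun y => by
    have := (g' y).2
    rw [LinearMap.mem_ker] at this ⊢
    exact (hD _).trans (congrArg (Prod.mk 0) this)
  have key : ∀ w, d w = 0 → ((0, w) : V × W) ∈ LinearMap.range k ⊔ LinearMap.range D := by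
    intro w hw
    let y : LinearMap.ker d := ⟨w, hw⟩
    have hy : N.mkQ (y - g' (N.mkQ y)) = 0 := by
      rw [map_sub, sub_eq_zero]
      exact (LinearMap.congr_fun hg' (N.mkQ y)).symm
    rw [Submodule.mkQ_apply, Submodule.Quotient.mk_eq_zero] at hy
    obtain ⟨b, hb⟩ := hy
    have hb' : d b = w - (g' (N.mkQ y) : W) := hb
    refine Submodule.mem_sup.2 ⟨_, ⟨N.mkQ y, rfl⟩, _, ⟨(0, b), rfl⟩, ?_⟩
    rw [hD, hb']
    simp [k]
  refine ⟨LinearMap.range ((LinearMap.ker D).subtype ∘ₗ g) ⊔ LinearMap.range k, ?_, ?_, ?_⟩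
  · refine Submodule.FG.sup ?_ ?_
    · exact Module.Finite.iff_fg.1 inferInstance
    · exact Module.Finite.iff_fg.1 inferInstance
  · refine sup_le ?_ ?_
    · rintro _ ⟨y, rfl⟩
      exact (g y).2
    · rintro _ ⟨y, rfl⟩
      exact hk y
  · intro z hz
    have e : f (g (f.rangeRestrict ⟨z, hz⟩)) = z.1 :=
      congrArg Subtype.val (LinearMap.congr_fun hg (f.rangeRestrict ⟨z, hz⟩))
    set p := g (f.rangeRestrict ⟨z, hz⟩) with hp
    have hzp : z - (p : V × W) = (0, z.2 - (p : V × W).2) := by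
      refine Prod.ext ?_ rfl
      exact sub_eq_zero.2 e.symm
    have hw : d (z.2 - (p : V × W).2) = 0 := by
      have : D (z - (p : V × W)) = 0 := by
        rw [map_sub, LinearMap.mem_ker.1 hz, LinearMap.mem_ker.1 p.2, sub_zero]
      rw [hzp, hD] at this
      exact congrArg Prod.snd this
    have := key _ hw
    rw [← hzp] at this
    rw [sup_assoc, ← add_sub_cancel (p : V × W) z]
    exact Submodule.add_mem_sup ⟨_, rfl⟩ this

/-! ### The mapping cone of the augmentation. -/

namespace AugmentedComplex

open FormalSum

section

variable {Ob : Type u} {A : AInfCategory.{u, v} Ob} {M : AInfModule.{u, v, w} A}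
  (C : AugmentedComplex M)

/-- The differential of the mapping cone of the augmentation, at an object `X`. -/
def coneD (X : Ob) : C.yoneda.obj X × M.obj X →ₗ[ℂ] C.yoneda.obj X × M.obj X :=
  -- No sign is needed for this to square to zero, because `t^1` anticommutes with the
  -- differentials.
  (C.yoneda.d X ∘ₗ LinearMap.fst ℂ _ _).prod
    ((C.toHom.map Chain.nil : C.yoneda.obj X →ₗ[ℂ] M.obj X).coprod (M.d X))

theorem coneD_apply (X : Ob) (z : C.yoneda.obj X × M.obj X) :
    C.coneD X z = (C.yoneda.d X z.1, C.toHom.map Chain.nil z.1 + M.d X z.2) := rfl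

/-- The cocycles `(c, x)` in the mapping cone, with `c` of degree `1 + q` and `x` of degree `q`. -/
def coneCocycles (X : Ob) (q : ℤ) : Set (C.yoneda.obj X × M.obj X) :=
  {z | z.1 ∈ (C.yoneda.obj X).gr (1 + q) ∧ z.2 ∈ (M.obj X).gr q ∧ C.coneD X z = 0}

/-- The mapping cone of the augmentation is acyclic at `X`. -/
def AcyclicAt (X : Ob) : Prop := LinearMap.ker (C.coneD X) ≤ LinearMap.range (C.coneD X)

theorem toHom_isQuasiIso (h : ∀ X, C.AcyclicAt X) : C.toHom.IsQuasiIso := by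
  intro X
  constructor
  · rw [injective_iff_map_eq_zero]
    intro y hy
    obtain ⟨⟨c, hc⟩, rfl⟩ := Submodule.Quotient.mk_surjective _ y
    obtain ⟨b, hb⟩ := (Submodule.Quotient.mk_eq_zero _).1 hy
    have hb' : M.d X b = C.toHom.map Chain.nil c := hb
    -- If `t^1(c) = d b`, then `(c, -b)` is a cone cocycle; the first component of a primitive
    -- exhibits `c` as a boundary.
    obtain ⟨z, hz⟩ := @h X (c, -b) (by
      rw [LinearMap.mem_ker] at hc ⊢
      rw [coneD_apply, hc, map_neg, hb', add_neg_cancel]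
      rfl)
    exact (Submodule.Quotient.mk_eq_zero _).2 ⟨z.1, congrArg Prod.fst hz⟩
  · intro y
    obtain ⟨⟨x, hx⟩, rfl⟩ := Submodule.Quotient.mk_surjective _ y
    -- A primitive of `(0, x)` consists of a cocycle `z.1` and an element `z.2` with `x = t^1(z.1) +
    -- d z.2`.
    obtain ⟨z, hz⟩ := @h X (0, x) (by
      rw [LinearMap.mem_ker] at hx ⊢
      rw [coneD_apply, hx, map_zero, map_zero, add_zero]
      rfl)
    have h₁ : C.yoneda.d X z.1 = 0 := congrArg Prod.fst hz
    have h₂ : C.toHom.map Chain.nil z.1 + M.d X z.2 = x := congrArg Prod.snd hz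
    refine ⟨Submodule.Quotient.mk ⟨z.1, h₁⟩, ?_⟩
    have e : M.d X (-z.2) = C.toHom.map Chain.nil z.1 - x := by
      rw [map_neg, ← h₂, sub_add_cancel_left]
    exact (Submodule.Quotient.eq _).2 ⟨-z.2, e⟩

theorem ker_coneD_le (X : Ob) :
    LinearMap.ker (C.coneD X) ≤ Submodule.span ℂ (⋃ q, C.coneCocycles X q) := by
  classical
  rintro ⟨c, x⟩ hz
  rw [LinearMap.mem_ker, coneD_apply] at hz
  have h₁ : C.yoneda.d X c = 0 := congrArg Prod.fst hz
  have h₂ : C.toHom.map Chain.nil c + M.d X x = 0 := congrArg Prod.snd hz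
  have hmem : ∀ q, ((C.yoneda.obj X).proj (1 + q) c, (M.obj X).proj q x) ∈
      C.coneCocycles X q := by
    intro q
    refine ⟨GrVect.proj_mem _ _ _, GrVect.proj_mem _ _ _, ?_⟩
    rw [coneD_apply]
    refine Prod.ext ?_ ?_
    · refine (GrVect.map_proj (C.yoneda.d X) 1 (fun n a ha => ?_) _ _).trans ?_
      · have := C.yoneda.mu_mem (Chain.nil : Chain A.hom X X) 0 n a rfl ha
        rwa [add_zero, add_comm] at this
      · rw [h₁, map_zero]
        rfl
    · refine (congrArg₂ (· + ·) (GrVect.map_proj (C.toHom.map (Chain.nil : Chain A.hom X X)) 0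
        (fun n a ha => ?_) _ _) (GrVect.map_proj (M.d X) 1 (fun n a ha => ?_) _ _)).trans ?_
      · have := C.toHom.map_mem (Chain.nil : Chain A.hom X X) 0 n a rfl ha
        rwa [add_comm] at this
      · have := M.mu_mem (Chain.nil : Chain A.hom X X) 0 n a rfl ha
        rwa [add_zero, add_comm] at this
      · simp only [zero_add]
        rw [← map_add, h₂, map_zero]
        rfl
  obtain ⟨s, hs⟩ := (C.yoneda.obj X).exists_sum_proj c
  obtain ⟨s', hs'⟩ := (M.obj X).exists_sum_proj x
  -- The degrees of `c` are shifted by `-1`, since the summand with index `q` contains the component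
  -- of `c` of degree `1 + q`.
  have e : (c, x) = ∑ q ∈ s' ∪ s.map (addLeftEmbedding (-1)),
      ((C.yoneda.obj X).proj (1 + q) c, (M.obj X).proj q x) := by
    refine Prod.ext ?_ ?_
    · rw [Prod.fst_sum]
      refine Eq.trans (hs ((s' ∪ s.map (addLeftEmbedding (-1))).map (addLeftEmbedding 1))
        fun n hn => ?_).symm (Finset.sum_map _ _ _)
      refine Finset.mem_map.2 ⟨-1 + n, Finset.mem_union_right _ ?_, ?_⟩
      · exact Finset.mem_map_of_mem (addLeftEmbedding (-1 : ℤ)) hn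
      · simp
    · rw [Prod.snd_sum]
      exact (hs' _ Finset.subset_union_left).symm
  rw [e]
  exact Submodule.sum_mem _ fun q _ => Submodule.subset_span (Set.mem_iUnion.2 ⟨q, hmem q⟩)

/-- The cohomology of the mapping cone is finite-dimensional. -/
theorem exists_spanning (X : Ob) (hA : ∀ Y, FiniteDimensional ℂ (A.hom X Y))
    (hM : FiniteDimensional ℂ (M.Cohomology X)) :
    ∃ (r : ℕ) (s : Fin r → C.yoneda.obj X × M.obj X), (∀ a, ∃ q, s a ∈ C.coneCocycles X q) ∧
      LinearMap.ker (C.coneD X) ≤ Submodule.span ℂ (Set.range s) ⊔ LinearMap.range (C.coneD X) := by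
  have : FiniteDimensional ℂ (C.yoneda.obj X) :=
    inferInstanceAs (FiniteDimensional ℂ ((i : C.Idx) → A.hom X (C.objAt i)))
  obtain ⟨P, hP, hP₁, hP₂⟩ := exists_fg_cone (M.d X) (C.coneD X) (fun x => by
    rw [coneD_apply, map_zero, map_zero, zero_add]) hM
  obtain ⟨t, ht, ht'⟩ := hP.exists_finset_span (hP₁.trans (C.ker_coneD_le X))
  refine ⟨t.card, fun a => t.equivFin.symm a, fun a => ?_, ?_⟩
  · exact Set.mem_iUnion.1 (ht (t.equivFin.symm a).2)
  · refine hP₂.trans (sup_le_sup_right (ht'.trans (Submodule.span_mono fun a ha => ?_)) _)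
    exact ⟨t.equivFin ⟨a, ha⟩, by simp⟩

/-! ### Effect of attaching a cocycle on the cone. -/

variable {X : Ob} (q : ℤ) (c : (j : C.Idx) → A.hom X (C.objAt j))
  (hc : ∀ j, c j ∈ (A.hom X (C.objAt j)).gr (1 + q - C.wt j))
  (hd : C.yonedaMu Chain.nil c = 0) (x : M.obj X) (hx : x ∈ (M.obj X).gr q)
  (hdx : C.augMap C.n Chain.nil c + M.mu Chain.nil x = 0)

/-- The inclusion of a mapping cone into that of an extended augmented complex. -/
def coneInclusion (Y : Ob) : C.yoneda.obj Y × M.obj Y →ₗ[ℂ]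
    (C.extend q c hc hd x hx hdx).yoneda.obj Y × M.obj Y where
  toFun z := (C.extendFamily q (V := fun Z => A.hom Y Z) (X := X) 0 z.1, z.2)
  map_add' _ _ := Prod.ext
    (funext (extend_cases (add_zero (0 : A.hom Y X)).symm fun _ => rfl)) rfl
  map_smul' t _ := Prod.ext
    (funext (extend_cases (smul_zero (A := A.hom Y X) t).symm fun _ => rfl)) rfl

theorem coneD_coneInclusion (Y : Ob) (z : C.yoneda.obj Y × M.obj Y) :
    (C.extend q c hc hd x hx hdx).coneD Y (C.coneInclusion q c hc hd x hx hdx Y z) =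
      C.coneInclusion q c hc hd x hx hdx Y (C.coneD Y z) := by
  refine Prod.ext (funext (extend_cases ?_ fun j => ?_)) ?_
  · refine (C.yonedaMu_extend_new q c hc hd x hx hdx _ _).trans ?_
    exact (A.mu_multilinear Y X).map_zero Chain.nil Chain.nil
  · refine (C.yonedaMu_extend_old q c hc hd x hx hdx _ _ j).trans ?_
    refine (congrArg₂ (· + ·) rfl ?_).trans (add_zero _)
    exact congrFun (LinearMap.congr_fun
      ((C.yonedaMu_multilinear Y X).map_zero Chain.nil Chain.nil) c) j
  · refine (congrArg₂ (· + ·) ((C.augMap_extend q c hc hd x hx hdx _ _).trans ?_) rfl)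
    refine (congrArg₂ (· + ·) rfl ?_).trans (add_zero _)
    refine (congrArg₂ (· + ·) ?_ ?_).trans (add_zero _)
    · exact LinearMap.congr_fun ((M.mu_multilinear Y X).map_zero Chain.nil Chain.nil) x
    · exact LinearMap.congr_fun ((C.augMap_multilinear C.n Y X).map_zero Chain.nil Chain.nil) c

/-- A pair `(c, x)`, as an element of the mapping cone. -/
def conePair : C.yoneda.obj X × M.obj X := (c, x)

/-- The element of the mapping cone of an extended augmented complex given by the identity. -/
def coneOne : (C.extend q c hc hd x hx hdx).yoneda.obj X × M.obj X :=
  (C.extendFamily q (V := fun Z => A.hom X Z) (A.one X) (fun _ => 0), 0)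

/-- Strict unitality: among all words applied to `e_X`, only the products of `c` and of `x` with
`e_X` survive. This is how attaching `(c, x)` turns it into a boundary. -/
theorem coneD_coneOne : (C.extend q c hc hd x hx hdx).coneD X (C.coneOne q c hc hd x hx hdx) =
    C.coneInclusion q c hc hd x hx hdx X (C.conePair c x) := by
  refine Prod.ext (funext (extend_cases ?_ fun j => ?_)) ?_
  · refine (C.yonedaMu_extend_new q c hc hd x hx hdx _ _).trans ?_
    exact A.mu_one X
  · refine (C.yonedaMu_extend_old q c hc hd x hx hdx _ _ j).trans ?_
    refine (congrArg₂ (· + ·) ?_ ?_).trans (zero_add _)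
    · exact congrFun (map_zero (C.yonedaMu (Chain.nil : Chain A.hom X X))) j
    · exact congrFun (C.insertAll_right_one c) j
  · have h₁ : C.augMap C.n (Chain.cons (A.one X) Chain.nil) c = 0 :=
      Finset.sum_eq_zero fun i _ =>
        C.augAll_insert_one C.n i (Chain.cons (c i) Chain.nil) Chain.nil le_rfl
    have h₂ : C.augMap C.n (Chain.nil : Chain A.hom X X) (fun _ => 0) +
        (M.mu (Chain.cons (A.one X) Chain.nil) x +
          C.augMap C.n (Chain.cons (A.one X) Chain.nil) c) = x := by
      rw [h₁, M.mu_one, add_zero]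
      exact (congrArg (· + x) (map_zero (C.augMap C.n (Chain.nil : Chain A.hom X X)))).trans
        (zero_add x)
    have h₃ := (C.augMap_extend q c hc hd x hx hdx Chain.nil
      (C.coneOne q c hc hd x hx hdx).1).trans h₂
    exact (congrArg₂ (· + ·) h₃ (map_zero (M.d X))).trans (add_zero x)

theorem exists_coneInclusion_eq {Y : Ob} (z : (C.extend q c hc hd x hx hdx).yoneda.obj Y × M.obj Y)
    (hz : z.1 (C.newIdx X q) = (0 : A.hom Y X)) :
    ∃ y, z = C.coneInclusion q c hc hd x hx hdx Y y :=
  ⟨(fun i => z.1 (C.oldIdx X q i), z.2), Prod.ext (funext (extend_cases hz fun _ => rfl)) rfl⟩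

theorem coneInclusion_injective (Y : Ob) :
    Function.Injective (C.coneInclusion q c hc hd x hx hdx Y) := fun _ _ h =>
  Prod.ext (funext fun i => congrFun (congrArg Prod.fst h) (C.oldIdx X q i))
    (congrArg (Prod.snd (α := (C.extend q c hc hd x hx hdx).yoneda.obj Y)) h)

/-- As `hom(Y, X) = 0`, the new summand is invisible at `Y` and the inclusion of the old cone is an
isomorphism of complexes there. -/
theorem AcyclicAt.extend {C : AugmentedComplex M} {Y : Ob} (h : C.AcyclicAt Y)
    {q : ℤ} {c : (j : C.Idx) → A.hom X (C.objAt j)}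
    {hc : ∀ j, c j ∈ (A.hom X (C.objAt j)).gr (1 + q - C.wt j)}
    {hd : C.yonedaMu Chain.nil c = 0} {x : M.obj X} {hx : x ∈ (M.obj X).gr q}
    {hdx : C.augMap C.n Chain.nil c + M.mu Chain.nil x = 0} (hY : ∀ a : A.hom Y X, a = 0) :
    (C.extend q c hc hd x hx hdx).AcyclicAt Y := by
  intro z hz
  obtain ⟨y, rfl⟩ := C.exists_coneInclusion_eq q c hc hd x hx hdx z (hY _)
  rw [LinearMap.mem_ker, coneD_coneInclusion] at hz
  have hy : C.coneD Y y = 0 := C.coneInclusion_injective q c hc hd x hx hdx Y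
    (hz.trans (map_zero _).symm)
  obtain ⟨b, rfl⟩ := h hy
  exact ⟨C.coneInclusion q c hc hd x hx hdx Y b, C.coneD_coneInclusion q c hc hd x hx hdx Y b⟩

/-- Adding a cocycle which is not a boundary to an augmented complex removes it from the cohomology
of the mapping cone. -/
theorem ker_coneD_extend_le (hX : Submodule.span ℂ {A.one X} = ⊤)
    (hb : C.conePair c x ∉ LinearMap.range (C.coneD X)) (S : Submodule ℂ (C.yoneda.obj X × M.obj X))
    (hS : LinearMap.ker (C.coneD X) ≤
      Submodule.span ℂ {C.conePair c x} ⊔ S ⊔ LinearMap.range (C.coneD X)) :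
    LinearMap.ker ((C.extend q c hc hd x hx hdx).coneD X) ≤
      S.map (C.coneInclusion q c hc hd x hx hdx X) ⊔
        LinearMap.range ((C.extend q c hc hd x hx hdx).coneD X) := by
  intro z hz
  -- Because `hom(X, X)` is spanned by `e_X`, the new cone is the old one plus the line through
  -- `coneOne`.
  obtain ⟨t, ht⟩ : ∃ t : ℂ, t • A.one X = z.1 (C.newIdx X q) :=
    Submodule.mem_span_singleton.1 (hX.ge (Submodule.mem_top (x := z.1 (C.newIdx X q))))
  obtain ⟨y, hy⟩ := C.exists_coneInclusion_eq q c hc hd x hx hdx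
    (z - t • C.coneOne q c hc hd x hx hdx) (sub_eq_zero.2 ht.symm)
  have hz' : z = C.coneInclusion q c hc hd x hx hdx X y + t • C.coneOne q c hc hd x hx hdx := by
    rw [← hy, sub_add_cancel]
  rw [LinearMap.mem_ker, hz', map_add, map_smul, coneD_coneInclusion, coneD_coneOne, ← map_smul,
    ← map_add] at hz
  have hyt : C.coneD X y + t • C.conePair c x = 0 :=
    C.coneInclusion_injective q c hc hd x hx hdx X (hz.trans (map_zero _).symm)
  -- Otherwise `D y + t (c, x) = 0` would make `(c, x)` a boundary. So no new cocycles arise, and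
  -- `y` is a cocycle of the old cone.
  have ht0 : t = 0 := by
    by_contra ht0
    refine hb ⟨-t⁻¹ • y, ?_⟩
    rw [map_smul, eq_neg_of_add_eq_zero_left hyt, neg_smul, smul_neg, neg_neg, smul_smul,
      inv_mul_cancel₀ ht0, one_smul]
  rw [ht0, zero_smul, add_zero] at hyt hz'
  obtain ⟨u, hu, b, ⟨b', rfl⟩, rfl⟩ := Submodule.mem_sup.1 (hS hyt)
  obtain ⟨u', hu', s, hs, rfl⟩ := Submodule.mem_sup.1 hu
  obtain ⟨l, rfl⟩ := Submodule.mem_span_singleton.1 hu'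
  rw [hz', map_add, map_add, map_smul, ← coneD_coneInclusion, ← coneD_coneOne, ← map_smul]
  exact Submodule.add_mem _ (Submodule.add_mem _ (Submodule.mem_sup_right ⟨_, rfl⟩)
    (Submodule.mem_sup_left ⟨s, hs, rfl⟩)) (Submodule.mem_sup_right ⟨_, rfl⟩)

/-! ### Killing the cohomology of the cone, one object at a time. -/

/-- An augmented complex can be extended so that the mapping cone becomes acyclic at `X`. -/
theorem exists_acyclicAt (hX : Submodule.span ℂ {A.one X} = ⊤) (r : ℕ) (C : AugmentedComplex M)
    (s : Fin r → C.yoneda.obj X × M.obj X) (hs : ∀ a, ∃ q, s a ∈ C.coneCocycles X q)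
    (h : LinearMap.ker (C.coneD X) ≤
      Submodule.span ℂ (Set.range s) ⊔ LinearMap.range (C.coneD X)) :
    ∃ C' : AugmentedComplex M, C'.AcyclicAt X ∧
      ∀ Y, (∀ a : A.hom Y X, a = 0) → C.AcyclicAt Y → C'.AcyclicAt Y := by
  induction r generalizing C with
  | zero =>
    refine ⟨C, ?_, fun _ _ h => h⟩
    rwa [Set.range_eq_empty, Submodule.span_empty, bot_sup_eq] at h
  | succ r ih =>
    have hrange : Submodule.span ℂ (Set.range s) =
        Submodule.span ℂ {s 0} ⊔ Submodule.span ℂ (Set.range (Fin.tail s)) := by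
      rw [← Submodule.span_union, ← Set.insert_eq, ← Fin.range_cons, Fin.cons_self_tail]
    rw [hrange] at h
    -- A boundary is dropped from the list, since attaching it would create a new class. Otherwise
    -- it is attached, and the images of the other cocycles span the remaining cohomology.
    by_cases hb : s 0 ∈ LinearMap.range (C.coneD X)
    · refine ih C (Fin.tail s) (fun a => hs _) (h.trans (sup_le (sup_le ?_ le_sup_left)
        le_sup_right))
      exact (Submodule.span_singleton_le_iff_mem _ _).2 (Submodule.mem_sup_right hb)
    · obtain ⟨q, hc, hx, hz⟩ := hs 0
      have hd : C.yoneda.d X (s 0).1 = 0 := congrArg Prod.fst hz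
      have hdx : C.toHom.map Chain.nil (s 0).1 + M.d X (s 0).2 = 0 := congrArg Prod.snd hz
      have hc' := fun j => Submodule.mem_pi.1 hc j trivial
      have hs' : ∀ a, ∃ q', C.coneInclusion q (s 0).1 hc' hd (s 0).2 hx hdx X (Fin.tail s a) ∈
          (C.extend q (s 0).1 hc' hd (s 0).2 hx hdx).coneCocycles X q' := by
        intro a
        obtain ⟨q', hc₁, hx₁, hz₁⟩ := hs a.succ
        refine ⟨q', Submodule.mem_pi.2 fun i _ => ?_, hx₁, ?_⟩
        · exact extend_cases (P := fun i => C.extendFamily q (V := fun Z => A.hom X Z)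
            (X := X) 0 (s a.succ).1 i ∈ (A.hom X ((C.toFormalSum.extend X q).objAt i)).gr
              (1 + q' - (C.toFormalSum.extend X q).wt i)) (Submodule.zero_mem _)
            (fun j => Submodule.mem_pi.1 hc₁ j trivial) i
        · exact (C.coneD_coneInclusion q (s 0).1 hc' hd (s 0).2 hx hdx X (Fin.tail s a)).trans
            ((congrArg _ hz₁).trans (map_zero _))
      have hker := C.ker_coneD_extend_le q (s 0).1 hc' hd (s 0).2 hx hdx hX hb _ h
      rw [Submodule.map_span, ← Set.range_comp] at hker
      obtain ⟨C', h₁, h₂⟩ := ih (C.extend q (s 0).1 hc' hd (s 0).2 hx hdx) _ hs' hker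
      exact ⟨C', h₁, fun Y hY h => h₂ Y hY (h.extend hY)⟩

variable (M) in
/-- The augmented complex without summands. -/
def empty : AugmentedComplex M where
  F := Empty
  K := fun _ => Empty
  deg := fun f => f.elim
  X := fun f => f.elim
  δ := fun i => i.1.elim
  δ_mem := fun i => i.1.elim
  exists_filtration := ⟨fun f => f.elim, fun i => i.1.elim⟩
  maurerCartan := fun i => i.1.elim
  n := fun i => i.1.elim
  n_mem := fun i => i.1.elim
  closed := fun i => i.1.elim

end

/-- Descending induction along the order of the objects, where `l` counts how many of the last
objects have been treated. -/
theorem exists_forall_acyclicAt {m : ℕ} {A : AInfCategory.{0, v} (Fin m)} (hA : A.IsDirected)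
    (M : AInfModule.{0, v, w} A) (hM : ∀ k : Fin m, FiniteDimensional ℂ (M.Cohomology k)) (l : ℕ) :
    ∃ C : AugmentedComplex M, ∀ k : Fin m, m ≤ k + l → C.AcyclicAt k := by
  induction l with
  | zero => exact ⟨empty M, fun k hk => absurd k.2 (not_lt.2 hk)⟩
  | succ l ih =>
    obtain ⟨C, hC⟩ := ih
    by_cases hl : l < m
    · let k : Fin m := ⟨m - (l + 1), by omega⟩
      have hfin : ∀ j, FiniteDimensional ℂ (A.hom k j) := by
        intro j
        rcases lt_trichotomy k j with h | h | h
        · exact hA.finiteDimensional k j h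
        · subst h
          exact ⟨⟨{A.one k}, by rw [Finset.coe_singleton]; exact hA.span_one k⟩⟩
        · have : Subsingleton (A.hom k j) :=
            ⟨fun a b => (hA.eq_zero k j h a).trans (hA.eq_zero k j h b).symm⟩
          infer_instance
      obtain ⟨r, s, hs, h⟩ := C.exists_spanning k hfin (hM k)
      obtain ⟨C', h₁, h₂⟩ := exists_acyclicAt (hA.span_one k) r C s hs h
      refine ⟨C', fun j hj => ?_⟩
      by_cases hjk : j = k
      · exact hjk ▸ h₁
      · have hj' : (j : ℕ) ≠ m - (l + 1) := fun h => hjk (Fin.ext h)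
        -- Objects treated earlier come after `k` in the order, so they have no morphisms to it and
        -- keep their acyclic cones.
        refine h₂ j (hA.eq_zero j k ?_) (hC j (by omega))
        show m - (l + 1) < (j : ℕ)
        omega
    · exact ⟨C, fun k _ => hC k (by omega)⟩

end AugmentedComplex

theorem proposition2p3 {m : ℕ} (A : AInfCategory.{0, v} (Fin m)) (hA : A.IsDirected)
    (M : AInfModule.{0, v, w} A) (hM : ∀ k : Fin m, FiniteDimensional ℂ (M.Cohomology k)) :
    ∃ C : TwistedComplex A, C.yoneda.QuasiIsomorphic M := by
  obtain ⟨C, hC⟩ := AugmentedComplex.exists_forall_acyclicAt hA M hM m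
  exact ⟨C.toTwistedComplex, C.toHom, C.toHom_isQuasiIso fun X => hC X (Nat.le_add_left _ _)⟩

end
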